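/- Let $\theta\in(0,\tfrac{\pi}{6})$, $c_0>0$, $\beta_2\ge 0$, $K_0<0$ and $K_2<0$ be real numbers, let $\mathbf d=(\cos\theta,\sin\theta)$ and let $\mathbf k_1=(1,0)$, $\mathbf k_2=\tfrac12(-1,\sqrt3)$, $\mathbf k_3=-\tfrac12(1,\sqrt3)$. For $\mu_0>0$ consider the six-dimensional real system for $(\mathbf A,\mathbf B)=((A_1,A_2,A_3),(B_1,B_2,B_3))\in\mathbb R^3\times\mathbb R^3$, $$ \partial_\Xi A_j=B_j,\qquad \partial_\Xi B_j=-\frac{1}{4(\mathbf d\cdot\mathbf k_j)^2}\Bigl(\mu_0A_j+c_0B_j+\beta_2A_kA_l+\bigl(K_0A_j^2+K_2(A_k^2+A_l^2)\bigr)A_j\Bigr), $$ where $j=1,2,3$ and $\{j,k,l\}=\{1,2,3\}$. Let $$ \mathbf A_{H_-}=(a,a,a),\quad a=\frac{-\beta_2+\sqrt{\beta_2^2-4\mu_0(K_0+2K_2)}}{2(K_0+2K_2)}<0,\qquad \mathbf A_R^{\pm}=\Bigl(\pm\sqrt{-\tfrac{\mu_0}{K_0}},0,0\Bigr), $$ so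 that $(\mathbf A_{H_-},0)$ (down-hexagons), $(\mathbf A_R^{\pm},0)$ (roll waves) and $(0,0)$ (trivial state) are equilibria. A heteroclinic orbit from an equilibrium $p$ to an equilibrium $q\neq p$ is a solution defined for all $\Xi\in\mathbb R$ that converges to $p$ as $\Xi\to-\infty$ and to $q$ as $\Xi\to+\infty$. 1. If $K_2<K_0$, then for every $\mu_0>0$ there is a heteroclinic orbit from $(\mathbf A_{H_-},0)$ to $(0,0)$. 2. If $K_0<K_2<0$, let $$ \mu_1=-\frac{\beta_2^2K_0}{2\sqrt2\sqrt{K_0(K_0+K_2)^3}-2K_0(K_0+3K_2)} . $$ Then $\mu_1\ge 0$, and $\mu_1>0$ if $\beta_2>0$. For every $\mu_0\in(0,\mu_1)$ there is a heteroclinic orbit from $(\mathbf A_{H_-},0)$ to $(0,0)$, and for every $\mu_0>\mu_1$ and each choice of sign there is a heteroclinic orbit from $(\mathbf A_R^{\pm},0)$ to $(0,0)$. -/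

import Mathlib

open Real Set Filter Topology Matrix

noncomputable section

/-- The generators `k₁, k₂, k₃` of the hexagonal Fourier lattice (indexed from `0`). -/
def hexGenerator : Fin 3 → Fin 2 → ℝ :=
  ![![1, 0], ![-1 / 2, √3 / 2], ![-1 / 2, -√3 / 2]]

/-- The unit direction of the front, `d = (cos θ, sin θ)`. -/
def frontDirection (θ : ℝ) : Fin 2 → ℝ := ![cos θ, sin θ]

/-- The quadratic and cubic terms of the `j`-th real amplitude equation,
`β₂ Aₖ Aₗ + (K₀ |Aⱼ|² + K₂ (|Aₖ|² + |Aₗ|²)) Aⱼ` with `{j, k, l} = {1, 2, 3}`.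
The index arithmetic is cyclic in `Fin 3`, so that `j + 1` and `j + 2` are the two other indices. -/
def amplitudeNonlinearity (β₂ K₀ K₂ : ℝ) (A : Fin 3 → ℝ) (j : Fin 3) : ℝ :=
  β₂ * A (j + 1) * A (j + 2)
    + (K₀ * |A j| ^ 2 + K₂ * (|A (j + 1)| ^ 2 + |A (j + 2)| ^ 2)) * A j

/-- The vector field of the leading-order reduced system on the real phase space
`ℝ⁶ = {(A, B) : A, B ∈ ℝ³}`. -/
def reducedField (θ c₀ μ₀ β₂ K₀ K₂ : ℝ) (p : (Fin 3 → ℝ) × (Fin 3 → ℝ)) :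
    (Fin 3 → ℝ) × (Fin 3 → ℝ) :=
  (p.2, fun j =>
    -(μ₀ / (4 * (frontDirection θ ⬝ᵥ hexGenerator j) ^ 2)) * p.1 j
      - c₀ / (4 * (frontDirection θ ⬝ᵥ hexGenerator j) ^ 2) * p.2 j
      - 1 / (4 * (frontDirection θ ⬝ᵥ hexGenerator j) ^ 2)
        * amplitudeNonlinearity β₂ K₀ K₂ p.1 j)

/-- Down-hexagons: all three amplitudes are equal to the root of
`μ₀ + β₂ a + (K₀ + 2 K₂) a² = 0` with the sign `+` in front of the square root. -/
def downHexagons (μ₀ β₂ K₀ K₂ : ℝ) : Fin 3 → ℝ :=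
  fun _ => (-β₂ + √(β₂ ^ 2 - 4 * μ₀ * (K₀ + 2 * K₂))) / (2 * (K₀ + 2 * K₂))

/-- The roll wave with positive first amplitude; the other one is its negative. -/
def rollWave (μ₀ K₀ : ℝ) : Fin 3 → ℝ := ![√(-μ₀ / K₀), 0, 0]

/-- The threshold `μ₁` as an explicit function of the coefficients. -/
def muOne (β₂ K₀ K₂ : ℝ) : ℝ :=
  -(β₂ ^ 2 * K₀) / (2 * √2 * √(K₀ * (K₀ + K₂) ^ 3) - 2 * K₀ * (K₀ + 3 * K₂))

/-- `u` is a heteroclinic orbit of `u' = F u` from `p` to `q`: a solution on all of `ℝ` that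
converges to the equilibrium `p` at `-∞` and to the different equilibrium `q` at `+∞`. -/
structure IsHeteroclinicOrbit {E : Type*} [NormedAddCommGroup E] [NormedSpace ℝ E]
    (F : E → E) (p q : E) (u : ℝ → E) : Prop where
  left_equilibrium : F p = 0
  right_equilibrium : F q = 0
  ne : p ≠ q
  solution : ∀ ξ : ℝ, HasDerivAt u (F (u ξ)) ξ
  tendsto_left : Tendsto u atBot (𝓝 p)
  tendsto_right : Tendsto u atTop (𝓝 q)

end

/-! The system is a damped gradient system: with `D j = 4 (d · kⱼ)²` and `V` the potential of the
nonlinearity, the energy `E = ∑ D j / 2 * B j ^ 2 + V(A)` satisfies `E' = -c₀ ∑ B j ^ 2`, so energy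
is constant only along equilibria. Along each ray on which it returns to zero slope, `V` first rises
from the origin and then falls. The Nehari set `N(A) = A · ∇V(A) = 0`, `A ≠ 0`, collects the tops of
these rays and contains every nontrivial equilibrium. If `P` minimises `V` there, then `{N ≥ 0, E <
V(P)}` is a bounded, forward invariant well whose only equilibrium is the origin, and `(P, 0)` lies
on its rim. Orbits started in the well near `(P, 0)` tend to the origin by LaSalle; rescaled to
their exit times from a small ball, they converge to an orbit that leaves `(P, 0)`, provided `P` is
an isolated critical point (`exists_isHeteroclinicOrbit_of_lyapunov`,
`exists_isHeteroclinicOrbit_of_nehari_min`). It remains to find the minimiser. If `K₂ < K₀`, AM-GM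
at fixed `|A|` gives the hexagons. If `K₀ < K₂`, a constrained minimiser is a free critical point,
and every critical point other than down-hexagons has at least the roll energy
(`le_amplitudePotential_of_le_roll_of_le_hexagons`). Rolls and hexagons exchange order exactly at
`μ₁` (`roll_sub_hexagons_energy`, `mul_amplitude_lt_iff_lt_muOne`). -/

/-! ### Global flow of a bounded Lipschitz vector field. -/

section Flow

variable {X : Type*} [NormedAddCommGroup X] [NormedSpace ℝ X]

/-- `φ x` is the solution of `u' = F u` through `x`, defined for all times. -/
structure IsGlobalFlow (F : X → X) (φ : X → ℝ → X) : Prop where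
  map_zero : ∀ x, φ x 0 = x
  hasDerivAt : ∀ x t, HasDerivAt (φ x) (F (φ x t)) t

theorem LipschitzWith.eq_of_hasDerivAt {F : X → X} {L : NNReal} (hL : LipschitzWith L F)
    {f g : ℝ → X} (hf : ∀ t, HasDerivAt f (F (f t)) t) (hg : ∀ t, HasDerivAt g (F (g t)) t)
    {t₀ : ℝ} (h : f t₀ = g t₀) : f = g :=
  ODE_solution_unique_univ (v := fun _ => F) (s := fun _ => univ) (K := L)
    (fun _ => hL.lipschitzOnWith) (fun t => ⟨hf t, mem_univ _⟩) (fun t => ⟨hg t, mem_univ _⟩) h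

theorem LipschitzWith.exists_solution [CompleteSpace X] {F : X → X} {L : NNReal}
    (hL : LipschitzWith L F) {M : NNReal} (hM : ∀ x, ‖F x‖ ≤ M) (x : X) :
    ∃ u : ℝ → X, u 0 = x ∧ ∀ t, HasDerivAt u (F (u t)) t := by
  have hloc : ∀ n : ℕ, ∃ α : ℝ → X, α 0 = x ∧
      ∀ t ∈ Ioo (-(n + 1 : ℝ)) (n + 1), HasDerivAt α (F (α t)) t := by
    intro n
    have h0 : (0 : ℝ) ∈ Icc (-(n + 1 : ℝ)) (n + 1) := by
      constructor <;> [linarith [n.cast_nonneg (α := ℝ)]; positivity]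
    -- A solution of speed at most `M` stays within `M * (n + 1)` of its start, so one Picard step
    -- covers the whole interval.
    have hp : IsPicardLindelof (fun _ => F) (⟨0, h0⟩ : Icc (-(n + 1 : ℝ)) (n + 1)) x
        (M * (n + 1)) 0 M L := by
      refine IsPicardLindelof.of_time_independent (fun y _ => hM y) hL.lipschitzOnWith ?_
      simp
    obtain ⟨α, h1, h2⟩ := hp.exists_eq_forall_mem_Icc_hasDerivWithinAt₀
    exact ⟨α, h1, fun t ht => (h2 t (Ioo_subset_Icc_self ht)).hasDerivAt (Icc_mem_nhds ht.1 ht.2)⟩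
  choose α hα0 hα using hloc
  have hagree : ∀ m n : ℕ, m ≤ n → ∀ t : ℝ, |t| < m + 1 → α m t = α n t := by
    intro m n hmn t ht
    have hmn' : (m : ℝ) ≤ n := by exact_mod_cast hmn
    refine ODE_solution_unique_of_mem_Ioo (v := fun _ => F) (s := fun _ => univ) (K := L)
      (a := -(m + 1 : ℝ)) (b := m + 1) (t₀ := 0) (fun _ _ => hL.lipschitzOnWith) ?_ ?_ ?_ ?_
      (abs_lt.1 ht)
    · constructor <;> linarith [m.cast_nonneg (α := ℝ)]
    · exact fun s hs => ⟨hα m s hs, mem_univ _⟩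
    · exact fun s hs => ⟨hα n s ⟨by linarith [hs.1], by linarith [hs.2]⟩, mem_univ _⟩
    · rw [hα0, hα0]
  refine ⟨fun t => α ⌈|t|⌉₊ t, by simp [hα0], fun t => ?_⟩
  have hlt : ∀ s : ℝ, |s| < ⌈|s|⌉₊ + 1 := fun s => (Nat.le_ceil _).trans_lt (lt_add_one _)
  -- The index `⌈|s|⌉₊` may jump at `t`; all indices near `t` are at most `⌈|t|⌉₊ + 1`, which serves
  -- as the common local solution.
  have hev : (fun s => α ⌈|s|⌉₊ s) =ᶠ[𝓝 t] α (⌈|t|⌉₊ + 1) := by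
    have : ∀ᶠ s : ℝ in 𝓝 t, |s| < ⌈|t|⌉₊ + 1 :=
      continuous_abs.continuousAt.eventually_lt_const (hlt t)
    filter_upwards [this] with s hs
    exact hagree _ _ (Nat.ceil_le.2 (by push_cast; exact hs.le)) s (hlt s)
  have heq : α ⌈|t|⌉₊ t = α (⌈|t|⌉₊ + 1) t := hev.self_of_nhds
  beta_reduce
  rw [heq]
  refine HasDerivAt.congr_of_eventuallyEq (hα _ t ?_) hev
  have := hlt t
  push_cast
  exact abs_lt.1 (by linarith)

theorem LipschitzWith.exists_isGlobalFlow [CompleteSpace X] {F : X → X} {L : NNReal}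
    (hL : LipschitzWith L F) {M : NNReal} (hM : ∀ x, ‖F x‖ ≤ M) :
    ∃ φ : X → ℝ → X, IsGlobalFlow F φ := by
  choose φ h0 h1 using hL.exists_solution hM
  exact ⟨φ, h0, h1⟩

namespace IsGlobalFlow

variable {F : X → X} {φ : X → ℝ → X} {L : NNReal}

theorem continuous_time (hφ : IsGlobalFlow F φ) (x : X) : Continuous (φ x) :=
  continuous_iff_continuousAt.2 fun t => (hφ.hasDerivAt x t).continuousAt

theorem eq_flow (hφ : IsGlobalFlow F φ) (hL : LipschitzWith L F) {u : ℝ → X}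
    (hu : ∀ t, HasDerivAt u (F (u t)) t) : u = φ (u 0) :=
  hL.eq_of_hasDerivAt hu (hφ.hasDerivAt _) (t₀ := 0) (hφ.map_zero _).symm

theorem add (hφ : IsGlobalFlow F φ) (hL : LipschitzWith L F) (x : X) (s t : ℝ) :
    φ x (s + t) = φ (φ x s) t := by
  have h := hφ.eq_flow hL (u := fun t => φ x (s + t))
    fun t => by simpa using (hφ.hasDerivAt x (s + t)).comp_const_add s t
  simpa using congrFun h t

theorem eq_of_equilibrium (hφ : IsGlobalFlow F φ) (hL : LipschitzWith L F) {x : X} (hx : F x = 0)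
    (t : ℝ) : φ x t = x := by
  have h := hφ.eq_flow hL (u := fun _ => x) fun t => by simpa [hx] using hasDerivAt_const t x
  exact (congrFun h t).symm

theorem dist_le (hφ : IsGlobalFlow F φ) (hL : LipschitzWith L F) (x y : X) (t : ℝ) :
    dist (φ x t) (φ y t) ≤ dist x y * exp (L * |t|) := by
  rcases le_total 0 t with ht | ht
  · have := dist_le_of_trajectories_ODE (v := fun _ => F) (f := φ x) (g := φ y) (a := 0) (b := t)
      (fun _ => hL) (hφ.continuous_time x).continuousOn
      (fun s _ => (hφ.hasDerivAt x s).hasDerivWithinAt) (hφ.continuous_time y).continuousOn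
      (fun s _ => (hφ.hasDerivAt y s).hasDerivWithinAt) (δ := dist x y)
      (by rw [hφ.map_zero, hφ.map_zero]) t ⟨ht, le_rfl⟩
    simpa [abs_of_nonneg ht] using this
  · have hneg : ∀ z s, HasDerivAt (fun r => φ z (-r)) (-F (φ z (-s))) s := fun z s => by
      simpa [Function.comp_def] using (hφ.hasDerivAt z (-s)).scomp s (hasDerivAt_neg s)
    have := dist_le_of_trajectories_ODE (v := fun _ => -F) (f := fun r => φ x (-r))
      (g := fun r => φ y (-r)) (a := 0) (b := -t)
      (fun _ => hL.neg) ((hφ.continuous_time x).comp continuous_neg).continuousOn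
      (fun s _ => (hneg x s).hasDerivWithinAt)
      ((hφ.continuous_time y).comp continuous_neg).continuousOn
      (fun s _ => (hneg y s).hasDerivWithinAt) (δ := dist x y)
      (by simp [hφ.map_zero]) (-t) ⟨by linarith, le_rfl⟩
    simpa [abs_of_nonpos ht] using this

theorem continuous_space (hφ : IsGlobalFlow F φ) (hL : LipschitzWith L F) (t : ℝ) :
    Continuous fun x => φ x t := by
  refine LipschitzWith.continuous (K := ⟨exp (L * |t|), (exp_pos _).le⟩)
    (LipschitzWith.of_dist_le_mul fun x y => ?_)
  rw [mul_comm]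
  exact hφ.dist_le hL x y t

end IsGlobalFlow

theorem ContDiff.exists_lipschitzWith_of_hasCompactSupport {F : X → X} (hF : ContDiff ℝ 1 F)
    (hc : HasCompactSupport F) : ∃ L : NNReal, LipschitzWith L F := by
  obtain ⟨C, hC⟩ := (hF.continuous_fderiv one_ne_zero).bounded_above_of_compact_support
    (hc.fderiv ℝ)
  refine ⟨C.toNNReal, lipschitzWith_of_nnnorm_fderiv_le (hF.differentiable one_ne_zero) fun x => ?_⟩
  rw [← NNReal.coe_le_coe, coe_nnnorm]
  exact (hC x).trans (Real.le_coe_toNNReal C)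

end Flow

/-- Only the forward half of the orbit is known to lie in `K`; monotonicity carries its lower bound
to negative times. -/
theorem Antitone.exists_tendsto_atTop_of_mem_isCompact {Y : Type*} [TopologicalSpace Y] {K : Set Y}
    (hK : IsCompact K) {H : Y → ℝ} (hH : Continuous H) {u : ℝ → Y}
    (hanti : Antitone fun t => H (u t)) (hmem : ∀ t, 0 ≤ t → u t ∈ K) :
    ∃ e, Tendsto (fun t => H (u t)) atTop (𝓝 e) := by
  obtain ⟨m, hm⟩ := (hK.image hH).bddBelow
  refine ⟨_, tendsto_atTop_ciInf hanti ⟨m, ?_⟩⟩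
  rintro _ ⟨t, rfl⟩
  exact (hm (mem_image_of_mem H (hmem _ (le_max_right t 0)))).trans (hanti (le_max_left t 0))

theorem Antitone.exists_tendsto_atBot_of_mem_isCompact {Y : Type*} [TopologicalSpace Y] {K : Set Y}
    (hK : IsCompact K) {H : Y → ℝ} (hH : Continuous H) {u : ℝ → Y}
    (hanti : Antitone fun t => H (u t)) (hmem : ∀ t ≤ 0, u t ∈ K) :
    ∃ e, Tendsto (fun t => H (u t)) atBot (𝓝 e) := by
  obtain ⟨m, hm⟩ := (hK.image hH).bddAbove
  refine ⟨_, tendsto_atBot_ciSup hanti ⟨m, ?_⟩⟩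
  rintro _ ⟨t, rfl⟩
  exact (hanti (min_le_left t 0)).trans (hm (mem_image_of_mem H (hmem _ (min_le_right t 0))))

/-! ### Heteroclinic orbits from a strict Lyapunov function. -/

section Heteroclinic

variable {X : Type*} [NormedAddCommGroup X] [NormedSpace ℝ X]

namespace IsGlobalFlow

variable {F : X → X} {φ : X → ℝ → X} {L : NNReal} {H : X → ℝ} {K : Set X}

/-- LaSalle's invariance principle, for either end of an orbit. -/
theorem tendsto_of_laSalle (hφ : IsGlobalFlow F φ) (hL : LipschitzWith L F) (hH : Continuous H)
    (hK : IsCompact K) {l : Filter ℝ} (hl : ∀ t, Tendsto (fun s => s + t) l l) {x z : X} {e : ℝ}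
    (hmem : ∀ᶠ s in l, φ x s ∈ K) (he : Tendsto (fun s => H (φ x s)) l (𝓝 e))
    (hz : ∀ y, (∀ t, φ y t ∈ K) → (∀ t, H (φ y t) = e) → y = z) :
    Tendsto (φ x) l (𝓝 z) := by
  refine hK.tendsto_nhds_of_unique_mapClusterPt hmem fun y _ hy => ?_
  -- The limit set is invariant: the flow through a cluster point consists of cluster points.
  have hcl : ∀ t, MapClusterPt (φ y t) l (φ x) := fun t => by
    refine MapClusterPt.of_comp (hl t) ?_
    have h1 := hy.continuousAt_comp (hφ.continuous_space hL t).continuousAt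
    have h2 : (fun z => φ z t) ∘ φ x = φ x ∘ fun s => s + t := by
      ext s; exact (hφ.add hL x s t).symm
    rwa [h2] at h1
  refine hz y (fun t => hK.isClosed.mem_of_mapClusterPt (hcl t) hmem) fun t => ?_
  have h1 : MapClusterPt (H (φ y t)) l (fun s => H (φ x s)) :=
    (hcl t).continuousAt_comp hH.continuousAt
  by_contra hne
  have h2 : Disjoint (𝓝 (H (φ y t))) (𝓝 e) := disjoint_nhds_nhds.2 hne
  exact (h1.mono (le_refl _) : (𝓝 (H (φ y t)) ⊓ map _ l).NeBot).ne
    (disjoint_iff.1 (h2.mono_right he))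

theorem antitone_of_fderiv_nonpos (hφ : IsGlobalFlow F φ) (hH : Differentiable ℝ H)
    (hdec : ∀ x, fderiv ℝ H x (F x) ≤ 0) (x : X) : Antitone fun t => H (φ x t) := by
  have hd : ∀ t, HasDerivAt (fun t => H (φ x t)) (fderiv ℝ H (φ x t) (F (φ x t))) t := fun t =>
    (hH (φ x t)).hasFDerivAt.comp_hasDerivAt t (hφ.hasDerivAt x t)
  exact antitone_of_deriv_nonpos (fun t => (hd t).differentiableAt)
    fun t => (hd t).deriv ▸ hdec _

/-- A relatively open sublevel set of a Lyapunov function in a closed set is forward invariant. -/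
theorem forward_invariant (hφ : IsGlobalFlow F φ)
    (hanti : ∀ x, Antitone fun t => H (φ x t)) (hK : IsClosed K) {h : ℝ}
    (hopen : IsOpen {x | x ∈ K ∧ H x < h}) {x : X} (hxK : x ∈ K) (hxh : H x < h) {t : ℝ}
    (ht : 0 ≤ t) : φ x t ∈ K ∧ H (φ x t) < h := by
  have hlt : ∀ s, 0 ≤ s → H (φ x s) < h := fun s hs =>
    lt_of_le_of_lt (by simpa [hφ.map_zero] using hanti x hs) hxh
  -- The times spent in `K` form a closed set, and openness of the sublevel part lets this set be
  -- continued past each of its points.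
  have hsub : Icc 0 t ⊆ φ x ⁻¹' K := by
    refine IsClosed.Icc_subset_of_forall_mem_nhdsWithin
      ((hK.preimage (hφ.continuous_time x)).inter isClosed_Icc)
      (by simpa [hφ.map_zero] using hxK) fun s hs => ?_
    refine mem_nhdsWithin_of_mem_nhds ?_
    have h1 : φ x ⁻¹' {x | x ∈ K ∧ H x < h} ∈ 𝓝 s :=
      (hopen.preimage (hφ.continuous_time x)).mem_nhds ⟨hs.1, hlt s hs.2.1⟩
    exact mem_of_superset h1 fun _ h => h.1
  exact ⟨hsub ⟨ht, le_rfl⟩, hlt t ht⟩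

/-- If orbits starting near the equilibrium `p` inside an invariant compact set `K` move away from
`p`, then some point at distance `r` from `p` has its whole backward orbit in `K`, near `p`. -/
theorem exists_backward_orbit (hφ : IsGlobalFlow F φ) (hL : LipschitzWith L F) {G : Set X}
    (hK : IsCompact K) (hGK : ∀ x ∈ G, ∀ t, 0 ≤ t → φ x t ∈ K) {p : X} (hFp : F p = 0)
    (hp : p ∈ closure G) {r : ℝ} (hr : 0 < r)
    (hleave : ∀ x ∈ G, ∃ t, 0 ≤ t ∧ r < dist (φ x t) p) :
    ∃ y, r ≤ dist y p ∧ ∀ t ≤ 0, φ y t ∈ K ∧ dist (φ y t) p ≤ r := by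
  obtain ⟨x, hxG, hx⟩ := mem_closure_iff_seq_limit.1 hp
  -- `T n` is the first time at distance at least `r`.
  have hexit : ∀ n, ∃ T, 0 ≤ T ∧ r ≤ dist (φ (x n) T) p ∧
      ∀ t, 0 ≤ t → t < T → dist (φ (x n) t) p < r := by
    intro n
    have hcont : Continuous fun t => dist (φ (x n) t) p :=
      (hφ.continuous_time (x n)).dist continuous_const
    obtain ⟨t₁, ht₁, hd₁⟩ := hleave _ (hxG n)
    have hcpt : IsCompact (Icc 0 t₁ ∩ {t | r ≤ dist (φ (x n) t) p}) :=
      isCompact_Icc.inter_right (isClosed_le continuous_const hcont)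
    obtain ⟨T, ⟨hT, hTr⟩, hmin⟩ := hcpt.exists_isLeast ⟨t₁, ⟨ht₁, le_rfl⟩, hd₁.le⟩
    refine ⟨T, hT.1, hTr, fun t ht htT => ?_⟩
    by_contra hcon
    exact absurd (hmin ⟨⟨ht, htT.le.trans hT.2⟩, not_lt.1 hcon⟩) (not_le.2 htT)
  choose T hT0 hTr hTlt using hexit
  obtain ⟨y, _, ψ, hψ, hy⟩ := hK.tendsto_subseq fun n => hGK _ (hxG n) _ (hT0 n)
  -- Separation from `p` grows at most exponentially, so starting points tending to `p` need
  -- unbounded time to reach distance `r`.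
  have hTtop : Tendsto T atTop atTop := by
    refine tendsto_atTop.2 fun S => ?_
    have h0 : Tendsto (fun n => dist (x n) p * exp (L * |S|)) atTop (𝓝 0) := by
      simpa using (tendsto_iff_dist_tendsto_zero.1 hx).mul_const (exp (L * |S|))
    filter_upwards [h0.eventually_lt_const hr] with n hn
    by_contra hcon
    have h1 := hφ.dist_le hL (x n) p (T n)
    rw [hφ.eq_of_equilibrium hL hFp] at h1
    have h2 : |T n| ≤ |S| := by
      rw [abs_of_nonneg (hT0 n)]; exact (not_le.1 hcon).le.trans (le_abs_self S)
    have h3 : dist (x n) p * exp (L * |T n|) ≤ dist (x n) p * exp (L * |S|) := by gcongr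
    linarith [hTr n]
  have hT' := hTtop.comp hψ.tendsto_atTop
  refine ⟨y, ge_of_tendsto' (hy.dist tendsto_const_nhds) fun n => hTr _, fun t ht => ?_⟩
  have hlim : Tendsto (fun n => φ (x (ψ n)) (T (ψ n) + t)) atTop (𝓝 (φ y t)) := by
    have := ((hφ.continuous_space hL t).tendsto y).comp hy
    exact this.congr fun n => (hφ.add hL _ _ _).symm
  have hev : ∀ᶠ n in atTop, 0 ≤ T (ψ n) + t := by
    filter_upwards [hT'.eventually_ge_atTop (-t)] with n hn
    simp only [Function.comp_apply] at hn
    linarith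
  refine ⟨hK.isClosed.mem_of_tendsto hlim (hev.mono fun n hn => hGK _ (hxG _) _ hn),
    le_of_tendsto (hlim.dist tendsto_const_nhds) ?_⟩
  -- The distance at `T n` is at most `r` by continuity from the left, except when the orbit already
  -- starts outside and `T n = 0`.
  have hTd : ∀ n, dist (φ (x n) (T n)) p ≤ r ∨ T n = 0 := by
    intro n
    rcases (hT0 n).eq_or_lt with h | h
    · exact Or.inr h.symm
    · left
      have hc : ContinuousWithinAt (fun t => dist (φ (x n) t) p) (Iio (T n)) (T n) :=
        ((hφ.continuous_time (x n)).dist continuous_const).continuousWithinAt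
      refine le_of_tendsto hc ?_
      filter_upwards [self_mem_nhdsWithin, mem_nhdsWithin_of_mem_nhds (lt_mem_nhds h)] with s h1 h2
      exact (hTlt n s h2.le h1).le
  filter_upwards [hev, hT'.eventually_gt_atTop 0] with n hn hpos
  rcases ht.eq_or_lt with rfl | ht
  · simpa using (hTd (ψ n)).resolve_right hpos.ne'
  · exact (hTlt _ _ hn (by linarith)).le

end IsGlobalFlow

variable [FiniteDimensional ℝ X]

/-- A heteroclinic orbit from a mountain pass `p` on the boundary of a compact well `K` of a strict
Lyapunov function `H` to the only equilibrium `q` in the well. -/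
theorem exists_isHeteroclinicOrbit_of_lyapunov {F : X → X} (hF : ContDiff ℝ 1 F) {H : X → ℝ}
    (hH : Differentiable ℝ H) (hdec : ∀ x, fderiv ℝ H x (F x) ≤ 0)
    (hstat : ∀ (u : ℝ → X) (a b e : ℝ), (∀ t ∈ Ioo a b, HasDerivAt u (F (u t)) t) →
      (∀ t ∈ Ioo a b, H (u t) = e) → ∀ t ∈ Ioo a b, F (u t) = 0)
    {K : Set X} (hK : IsCompact K) {h : ℝ} (hopen : IsOpen {x | x ∈ K ∧ H x < h}) {p q : X}
    (hFp : F p = 0) (hp : H p = h) (hpc : p ∈ closure {x | x ∈ K ∧ H x < h}) (hFq : F q = 0)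
    (hq : H q < h) (huniq : ∀ x ∈ K, H x < h → F x = 0 → x = q) {r : ℝ} (hr : 0 < r)
    (hiso : ∀ x ∈ K, dist x p ≤ r → F x = 0 → x = p) :
    ∃ u : ℝ → X, IsHeteroclinicOrbit F p q u := by
  have hpq : p ≠ q := by rintro rfl; linarith
  obtain ⟨R, hR, hKR⟩ : ∃ R : ℝ, 0 < R ∧ K ⊆ Metric.closedBall 0 R := by
    obtain ⟨R, hR⟩ := hK.isBounded.subset_closedBall (0 : X)
    exact ⟨max R 1, by positivity, hR.trans (Metric.closedBall_subset_closedBall (le_max_left _ _))⟩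
  -- Cutting off outside a ball containing `K` gives a bounded Lipschitz field; a factor `χ ≥ 0`
  -- preserves the decay of `H`.
  let χ : ContDiffBump (0 : X) := ⟨R, R + 1, hR, by linarith⟩
  have hχK : ∀ x ∈ K, χ x = 1 := fun x hx => χ.one_of_mem_closedBall (hKR hx)
  set F' : X → X := fun x => χ x • F x with hF'
  have hF'c : ContDiff ℝ 1 F' := χ.contDiff.smul hF
  have hF's : HasCompactSupport F' := χ.hasCompactSupport.smul_right
  obtain ⟨L, hL⟩ := hF'c.exists_lipschitzWith_of_hasCompactSupport hF's
  obtain ⟨M, hM⟩ := hF'c.continuous.bounded_above_of_compact_support hF's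
  have : CompleteSpace X := FiniteDimensional.complete ℝ X
  obtain ⟨φ, hφ⟩ := hL.exists_isGlobalFlow (M := M.toNNReal)
    fun x => (hM x).trans (Real.le_coe_toNNReal M)
  have hdec' : ∀ x, fderiv ℝ H x (F' x) ≤ 0 := fun x => by
    simp only [hF', map_smul, smul_eq_mul]
    exact mul_nonpos_of_nonneg_of_nonpos χ.nonneg (hdec x)
  have hanti := hφ.antitone_of_fderiv_nonpos hH hdec'
  have hderiv : ∀ x t, φ x t ∈ K → HasDerivAt (φ x) (F (φ x t)) t := fun x t hx => by
    simpa [hF', hχK _ hx] using hφ.hasDerivAt x t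
  have hinv : ∀ x, x ∈ K ∧ H x < h → ∀ t, 0 ≤ t → φ x t ∈ K ∧ H (φ x t) < h := fun x hx t ht =>
    hφ.forward_invariant hanti hK.isClosed hopen hx.1 hx.2 ht
  have hF'p : F' p = 0 := by simp [hF', hFp]
  have hconv : ∀ x, x ∈ K ∧ H x < h → Tendsto (φ x) atTop (𝓝 q) := by
    intro x hx
    obtain ⟨e, he⟩ := (hanti x).exists_tendsto_atTop_of_mem_isCompact hK
      hH.continuous fun t ht => (hinv x hx t ht).1
    refine hφ.tendsto_of_laSalle hL hH.continuous hK
      (fun t => tendsto_atTop_add_const_right _ t tendsto_id)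
      ((eventually_ge_atTop 0).mono fun t ht => (hinv x hx t ht).1) he fun y hyK hye => ?_
    have h0 : φ y 0 = y := hφ.map_zero y
    refine huniq y (h0 ▸ hyK 0) ?_ ?_
    · rw [← h0, hye]
      refine lt_of_le_of_lt ((hanti x).le_of_tendsto he 0) ?_
      simpa [hφ.map_zero] using hx.2
    · simpa [h0] using hstat (φ y) (-1) 1 e (fun t _ => hderiv y t (hyK t)) (fun t _ => hye t) 0
        (by norm_num)
  -- With `ρ` below `dist p q`, orbits converging to `q` must leave the `ρ`-ball around `p`.
  set ρ := min r (dist p q / 2) with hρ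
  have hdpq : 0 < dist p q := dist_pos.2 hpq
  have hρ0 : 0 < ρ := lt_min hr (by linarith)
  obtain ⟨y, hyρ, hy⟩ := hφ.exists_backward_orbit hL hK
    (G := {x | x ∈ K ∧ H x < h}) (fun x hx t ht => (hinv x hx t ht).1) hF'p hpc hρ0 fun x hx => by
      have h1 : ∀ᶠ t in atTop, ρ < dist (φ x t) p := by
        refine ((hconv x hx).dist tendsto_const_nhds).eventually_const_lt ?_
        rw [dist_comm]
        exact (min_le_right _ _).trans_lt (by linarith)
      obtain ⟨t, h2, h3⟩ := (h1.and (eventually_ge_atTop 0)).exists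
      exact ⟨t, h3, h2⟩
  have hyp : ∀ z ∈ K, dist z p ≤ ρ → F z = 0 → z = p := fun z h1 h2 h3 =>
    hiso z h1 (h2.trans (min_le_left _ _)) h3
  obtain ⟨e, he⟩ := (hanti y).exists_tendsto_atBot_of_mem_isCompact hK
    hH.continuous fun t ht => (hy t ht).1
  have hleft : Tendsto (φ y) atBot (𝓝 p) := by
    refine hφ.tendsto_of_laSalle hL hH.continuous (hK.inter_right Metric.isClosed_closedBall)
      (fun t => tendsto_atBot_add_const_right _ t tendsto_id)
      ((eventually_le_atBot 0).mono fun t ht => ⟨(hy t ht).1, Metric.mem_closedBall.2 (hy t ht).2⟩)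
      he fun z hzK hze => ?_
    have h0 : φ z 0 = z := hφ.map_zero z
    have hz := hzK 0
    rw [h0] at hz
    refine hyp z hz.1 hz.2 ?_
    simpa [h0] using hstat (φ z) (-1) 1 e (fun t _ => hderiv z t (hzK t).1) (fun t _ => hze t) 0
      (by norm_num)
  have hle : ∀ t, H (φ y t) ≤ h := fun t => by
    have h1 : Tendsto (fun t => H (φ y t)) atBot (𝓝 (H p)) :=
      (hH.continuous.tendsto p).comp hleft
    rw [hp] at h1
    exact (hanti y).ge_of_tendsto h1 t
  have h0 : φ y 0 = y := hφ.map_zero y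
  -- Were `H y = h`, the energy would be constant on `(-1, 0)`; the orbit would rest there at an
  -- equilibrium near `p`, hence at `p`, forcing `y = p` against `ρ ≤ dist y p`.
  have hyh : H y < h := by
    refine lt_of_le_of_ne (h0 ▸ hle 0) fun heq => ?_
    have hconst : ∀ t ∈ Ioo (-1 : ℝ) 0, H (φ y t) = h := fun t ht =>
      le_antisymm (hle t) (by rw [← heq]; simpa [h0] using hanti y ht.2.le)
    have hmem : (-1 / 2 : ℝ) ∈ Ioo (-1 : ℝ) 0 := by norm_num
    have h1 := hstat (φ y) (-1) 0 h (fun t ht => hderiv y t (hy t ht.2.le).1) hconst _ hmem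
    have h2 := hyp _ (hy _ hmem.2.le).1 (hy _ hmem.2.le).2 h1
    have h3 := hφ.add hL y (-1 / 2) (1 / 2)
    rw [h2, hφ.eq_of_equilibrium hL hF'p] at h3
    norm_num [h0] at h3
    rw [h3, dist_self] at hyρ
    linarith
  have hyK : y ∈ K := h0 ▸ (hy 0 le_rfl).1
  have hmem : ∀ t, φ y t ∈ K := fun t =>
    (le_total t 0).elim (fun ht => (hy t ht).1) fun ht => (hinv y ⟨hyK, hyh⟩ t ht).1
  exact ⟨φ y, hFp, hFq, hpq, fun t => hderiv y t (hmem t), hleft, hconv y ⟨hyK, hyh⟩⟩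

end Heteroclinic

/-! ### The potential and its Nehari function. -/

noncomputable section Potential

/-- The potential of the amplitude nonlinearity, including the linear term `μ₀ A`. -/
def amplitudePotential (μ₀ β₂ K₀ K₂ : ℝ) (A : Fin 3 → ℝ) : ℝ :=
  μ₀ / 2 * (A 0 ^ 2 + A 1 ^ 2 + A 2 ^ 2) + β₂ * (A 0 * A 1 * A 2)
    + K₀ / 4 * (A 0 ^ 4 + A 1 ^ 4 + A 2 ^ 4)
    + K₂ / 2 * (A 0 ^ 2 * A 1 ^ 2 + A 1 ^ 2 * A 2 ^ 2 + A 2 ^ 2 * A 0 ^ 2)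

/-- The gradient of `amplitudePotential`. -/
def amplitudeGradient (μ₀ β₂ K₀ K₂ : ℝ) (A : Fin 3 → ℝ) (j : Fin 3) : ℝ :=
  μ₀ * A j + amplitudeNonlinearity β₂ K₀ K₂ A j

/-- The radial derivative `A · ∇V(A)` of the potential, whose zero set is the Nehari manifold. -/
def nehari (μ₀ β₂ K₀ K₂ : ℝ) (A : Fin 3 → ℝ) : ℝ :=
  μ₀ * (A 0 ^ 2 + A 1 ^ 2 + A 2 ^ 2) + 3 * β₂ * (A 0 * A 1 * A 2)
    + K₀ * (A 0 ^ 4 + A 1 ^ 4 + A 2 ^ 4)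
    + 2 * K₂ * (A 0 ^ 2 * A 1 ^ 2 + A 1 ^ 2 * A 2 ^ 2 + A 2 ^ 2 * A 0 ^ 2)

variable {μ₀ β₂ K₀ K₂ : ℝ} {A : Fin 3 → ℝ}

theorem amplitudeGradient_zero : amplitudeGradient μ₀ β₂ K₀ K₂ A 0 =
    μ₀ * A 0 + β₂ * A 1 * A 2 + (K₀ * A 0 ^ 2 + K₂ * (A 1 ^ 2 + A 2 ^ 2)) * A 0 := by
  simp only [amplitudeGradient, amplitudeNonlinearity, sq_abs]
  norm_num
  ring

theorem amplitudeGradient_one : amplitudeGradient μ₀ β₂ K₀ K₂ A 1 =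
    μ₀ * A 1 + β₂ * A 2 * A 0 + (K₀ * A 1 ^ 2 + K₂ * (A 2 ^ 2 + A 0 ^ 2)) * A 1 := by
  simp only [amplitudeGradient, amplitudeNonlinearity, sq_abs,
    show (1 : Fin 3) + 1 = 2 from rfl, show (1 : Fin 3) + 2 = 0 from rfl]
  ring

theorem amplitudeGradient_two : amplitudeGradient μ₀ β₂ K₀ K₂ A 2 =
    μ₀ * A 2 + β₂ * A 0 * A 1 + (K₀ * A 2 ^ 2 + K₂ * (A 0 ^ 2 + A 1 ^ 2)) * A 2 := by
  simp only [amplitudeGradient, amplitudeNonlinearity, sq_abs,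
    show (2 : Fin 3) + 1 = 0 from rfl, show (2 : Fin 3) + 2 = 1 from rfl]
  ring

theorem nehari_eq_sum : nehari μ₀ β₂ K₀ K₂ A = ∑ j, A j * amplitudeGradient μ₀ β₂ K₀ K₂ A j := by
  rw [Fin.sum_univ_three, amplitudeGradient_zero, amplitudeGradient_one, amplitudeGradient_two,
    nehari]
  ring

theorem nehari_eq_zero_of_gradient (h : ∀ j, amplitudeGradient μ₀ β₂ K₀ K₂ A j = 0) :
    nehari μ₀ β₂ K₀ K₂ A = 0 := by
  simp [nehari_eq_sum, h]

@[fun_prop]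
theorem contDiff_amplitudePotential {n : WithTop ℕ∞} :
    ContDiff ℝ n (amplitudePotential μ₀ β₂ K₀ K₂) := by
  unfold amplitudePotential
  fun_prop

@[fun_prop]
theorem contDiff_nehari {n : WithTop ℕ∞} : ContDiff ℝ n (nehari μ₀ β₂ K₀ K₂) := by
  unfold nehari
  fun_prop

theorem hasDerivAt_amplitudePotential {u : ℝ → Fin 3 → ℝ} {v : Fin 3 → ℝ} {t : ℝ}
    (hu : ∀ j, HasDerivAt (fun s => u s j) (v j) t) :
    HasDerivAt (fun s => amplitudePotential μ₀ β₂ K₀ K₂ (u s))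
      (∑ j, amplitudeGradient μ₀ β₂ K₀ K₂ (u t) j * v j) t := by
  have h0 := hu 0
  have h1 := hu 1
  have h2 := hu 2
  have h := (((((h0.pow 2).add (h1.pow 2)).add (h2.pow 2)).const_mul (μ₀ / 2)).add
    (((h0.mul h1).mul h2).const_mul β₂)).add
    ((((h0.pow 4).add (h1.pow 4)).add (h2.pow 4)).const_mul (K₀ / 4)) |>.add
    (((((h0.pow 2).mul (h1.pow 2)).add ((h1.pow 2).mul (h2.pow 2))).add
      ((h2.pow 2).mul (h0.pow 2))).const_mul (K₂ / 2))
  refine h.congr_deriv ?_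
  rw [Fin.sum_univ_three, amplitudeGradient_zero, amplitudeGradient_one, amplitudeGradient_two]
  simp
  ring

theorem sq_sum_pos (hA : A ≠ 0) : 0 < A 0 ^ 2 + A 1 ^ 2 + A 2 ^ 2 := by
  by_contra h
  apply hA
  have h0 := sq_nonneg (A 0)
  have h1 := sq_nonneg (A 1)
  have h2 := sq_nonneg (A 2)
  have e0 : A 0 = 0 := pow_eq_zero_iff two_ne_zero |>.1 (by linarith)
  have e1 : A 1 = 0 := pow_eq_zero_iff two_ne_zero |>.1 (by linarith)
  have e2 : A 2 = 0 := pow_eq_zero_iff two_ne_zero |>.1 (by linarith)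
  ext j
  fin_cases j <;> assumption

/-- AM-GM for `a = x²`, `b = y²`, `c = z²`: the difference is `(a+b+c)/2 * ∑ (a-b)² + 3 * ∑ a
(b-c)²`. -/
theorem sq_prod_le_cube_sum_sq (x y z : ℝ) :
    27 * (x * y * z) ^ 2 ≤ (x ^ 2 + y ^ 2 + z ^ 2) ^ 3 := by
  nlinarith [mul_nonneg (sq_nonneg x) (sq_nonneg (y ^ 2 - z ^ 2)),
    mul_nonneg (sq_nonneg y) (sq_nonneg (x ^ 2 - z ^ 2)),
    mul_nonneg (sq_nonneg z) (sq_nonneg (x ^ 2 - y ^ 2)),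
    mul_nonneg (add_nonneg (add_nonneg (sq_nonneg x) (sq_nonneg y)) (sq_nonneg z))
      (sq_nonneg (x ^ 2 - y ^ 2)),
    mul_nonneg (add_nonneg (add_nonneg (sq_nonneg x) (sq_nonneg y)) (sq_nonneg z))
      (sq_nonneg (x ^ 2 - z ^ 2)),
    mul_nonneg (add_nonneg (add_nonneg (sq_nonneg x) (sq_nonneg y)) (sq_nonneg z))
      (sq_nonneg (y ^ 2 - z ^ 2))]

/-- The cubic term is controlled by the quadratic and quartic ones. -/
theorem abs_cubic_le (β₂ : ℝ) {c : ℝ} (hc : 0 < c) (A : Fin 3 → ℝ) :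
    |3 * β₂ * (A 0 * A 1 * A 2)| ≤ c * (A 0 ^ 2 + A 1 ^ 2 + A 2 ^ 2)
      + 9 * β₂ ^ 2 / (4 * c) * (A 0 ^ 2 + A 1 ^ 2 + A 2 ^ 2) ^ 2 := by
  have hP := sq_prod_le_cube_sum_sq (A 0) (A 1) (A 2)
  set S := A 0 ^ 2 + A 1 ^ 2 + A 2 ^ 2 with hS
  have hS0 : 0 ≤ S := by positivity
  refine abs_le_of_sq_le_sq ?_ (by positivity)
  -- `(u + v)² = (u - v)² + 4uv`, with the weights chosen so that `4uv = 9 β₂² S³`.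
  have h1 : (c * S + 9 * β₂ ^ 2 / (4 * c) * S ^ 2) ^ 2
      = (c * S - 9 * β₂ ^ 2 / (4 * c) * S ^ 2) ^ 2 + 9 * β₂ ^ 2 * S ^ 3 := by
    field_simp
    ring
  have h2 : (3 * β₂ * (A 0 * A 1 * A 2)) ^ 2 ≤ 9 * β₂ ^ 2 * S ^ 3 := by
    have : (A 0 * A 1 * A 2) ^ 2 ≤ S ^ 3 := by nlinarith [sq_nonneg (A 0 * A 1 * A 2)]
    calc (3 * β₂ * (A 0 * A 1 * A 2)) ^ 2 = 9 * β₂ ^ 2 * (A 0 * A 1 * A 2) ^ 2 := by ring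
      _ ≤ _ := by gcongr
  rw [h1]
  linarith [sq_nonneg (c * S - 9 * β₂ ^ 2 / (4 * c) * S ^ 2)]

theorem quartic_pos (hK₀ : K₀ < 0) (hK₂ : K₂ < 0) (hA : A ≠ 0) :
    K₀ * (A 0 ^ 4 + A 1 ^ 4 + A 2 ^ 4)
      + 2 * K₂ * (A 0 ^ 2 * A 1 ^ 2 + A 1 ^ 2 * A 2 ^ 2 + A 2 ^ 2 * A 0 ^ 2) < 0 := by
  have hS := pow_pos (sq_sum_pos hA) 2
  have h4 : 0 < A 0 ^ 4 + A 1 ^ 4 + A 2 ^ 4 := by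
    nlinarith [sq_nonneg (A 0 ^ 2 - A 1 ^ 2), sq_nonneg (A 1 ^ 2 - A 2 ^ 2),
      sq_nonneg (A 2 ^ 2 - A 0 ^ 2)]
  have h22 : 0 ≤ A 0 ^ 2 * A 1 ^ 2 + A 1 ^ 2 * A 2 ^ 2 + A 2 ^ 2 * A 0 ^ 2 := by positivity
  nlinarith

/-- The Nehari function is positive near the origin, except at the origin itself. -/
theorem exists_nehari_pos (hμ : 0 < μ₀) (hK₀ : K₀ < 0) (hK₂ : K₂ < 0) : ∃ δ > 0, ∀ A : Fin 3 → ℝ,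
    A ≠ 0 → A 0 ^ 2 + A 1 ^ 2 + A 2 ^ 2 < δ → 0 < nehari μ₀ β₂ K₀ K₂ A := by
  have hc : 0 < 9 * β₂ ^ 2 / (4 * (μ₀ / 2)) - K₀ - 2 * K₂ := by
    have : 0 ≤ 9 * β₂ ^ 2 / (4 * (μ₀ / 2)) := by positivity
    linarith
  -- Half of the quadratic term absorbs the cubic one; the other half beats the remaining multiple
  -- of `S²` when `S` is below this quotient.
  refine ⟨μ₀ / 2 / (9 * β₂ ^ 2 / (4 * (μ₀ / 2)) - K₀ - 2 * K₂), by positivity, fun A hA hAδ => ?_⟩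
  have hS := sq_sum_pos hA
  have h3 := (abs_le.1 (abs_cubic_le β₂ (half_pos hμ) A)).1
  rw [lt_div_iff₀ hc] at hAδ
  set C := 9 * β₂ ^ 2 / (4 * (μ₀ / 2))
  unfold nehari
  have h4 : A 0 ^ 4 + A 1 ^ 4 + A 2 ^ 4 ≤ (A 0 ^ 2 + A 1 ^ 2 + A 2 ^ 2) ^ 2 := by
    have : 0 ≤ A 0 ^ 2 * A 1 ^ 2 + A 1 ^ 2 * A 2 ^ 2 + A 2 ^ 2 * A 0 ^ 2 := by positivity
    linarith
  have h22 : A 0 ^ 2 * A 1 ^ 2 + A 1 ^ 2 * A 2 ^ 2 + A 2 ^ 2 * A 0 ^ 2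
      ≤ (A 0 ^ 2 + A 1 ^ 2 + A 2 ^ 2) ^ 2 := by
    have : 0 ≤ A 0 ^ 4 + A 1 ^ 4 + A 2 ^ 4 := by positivity
    have : 0 ≤ A 0 ^ 2 * A 1 ^ 2 + A 1 ^ 2 * A 2 ^ 2 + A 2 ^ 2 * A 0 ^ 2 := by positivity
    linarith
  have h5 := mul_le_mul_of_nonpos_left h4 hK₀.le
  have h6 := mul_le_mul_of_nonpos_left h22 hK₂.le
  have h7 := mul_lt_mul_of_pos_left hAδ hS
  linarith

theorem exists_sq_sum_le_of_nehari_nonneg (hμ : 0 < μ₀) (hK₀ : K₀ < 0) (hK₂ : K₂ < 0) :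
    ∃ R, ∀ A : Fin 3 → ℝ, 0 ≤ nehari μ₀ β₂ K₀ K₂ A → A 0 ^ 2 + A 1 ^ 2 + A 2 ^ 2 ≤ R := by
  obtain ⟨k, hk, h0, h2⟩ : ∃ k > 0, K₀ ≤ -k ∧ K₂ ≤ -k :=
    ⟨min (-K₀) (-K₂), lt_min (by linarith) (by linarith), by linarith [min_le_left (-K₀) (-K₂)],
      by linarith [min_le_right (-K₀) (-K₂)]⟩
  -- Here `c` is large enough for the cubic term to cost at most half of the quartic decay `k S²`;
  -- the `+ 1` keeps it positive when `β₂ = 0`.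
  obtain ⟨c, hc, hck⟩ : ∃ c > 0, 9 * β₂ ^ 2 / (4 * c) ≤ k / 2 := by
    refine ⟨9 * (β₂ ^ 2 + 1) / (2 * k), by positivity, ?_⟩
    rw [div_le_iff₀ (by positivity)]
    field_simp
    nlinarith
  refine ⟨(μ₀ + c) / (k / 2), fun A hA => ?_⟩
  by_cases hA0 : A = 0
  · subst hA0
    simp only [Pi.zero_apply]
    ring_nf
    positivity
  have hS := sq_sum_pos hA0
  rw [le_div_iff₀ (by positivity)]
  have h3 := (abs_le.1 (abs_cubic_le β₂ hc A)).2
  have h4 := mul_le_mul_of_nonneg_right hck (sq_nonneg (A 0 ^ 2 + A 1 ^ 2 + A 2 ^ 2))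
  have h5 := mul_le_mul_of_nonneg_right h0 (by positivity : 0 ≤ A 0 ^ 4 + A 1 ^ 4 + A 2 ^ 4)
  have h6 := mul_le_mul_of_nonneg_right h2
    (by positivity : 0 ≤ A 0 ^ 2 * A 1 ^ 2 + A 1 ^ 2 * A 2 ^ 2 + A 2 ^ 2 * A 0 ^ 2)
  unfold nehari at hA
  refine le_of_mul_le_mul_left ?_ hS
  linarith

theorem isCompact_nehari_nonneg (hμ : 0 < μ₀) (hK₀ : K₀ < 0) (hK₂ : K₂ < 0) :
    IsCompact {A | 0 ≤ nehari μ₀ β₂ K₀ K₂ A} := by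
  obtain ⟨R, hR⟩ := exists_sq_sum_le_of_nehari_nonneg (β₂ := β₂) hμ hK₀ hK₂
  refine Metric.isCompact_of_isClosed_isBounded
    (isClosed_le continuous_const (contDiff_nehari (n := 0)).continuous) ?_
  refine isBounded_iff_forall_norm_le.2 ⟨√R, fun A hA => ?_⟩
  refine (pi_norm_le_iff_of_nonneg (sqrt_nonneg _)).2 fun j => abs_le_sqrt ?_
  have h := hR A hA
  have h0 := sq_nonneg (A 0)
  have h1 := sq_nonneg (A 1)
  have h2 := sq_nonneg (A 2)
  fin_cases j <;> simp <;> linarith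

/-- On the Nehari manifold the potential is the maximum along the ray. -/
theorem amplitudePotential_smul_add_le (hμ : 0 < μ₀) (hK₀ : K₀ < 0) (hK₂ : K₂ < 0)
    (hN : nehari μ₀ β₂ K₀ K₂ A = 0) {s : ℝ} (hs : 0 ≤ s) :
    amplitudePotential μ₀ β₂ K₀ K₂ (s • A)
      + μ₀ / 6 * (1 - s) ^ 2 * (A 0 ^ 2 + A 1 ^ 2 + A 2 ^ 2) ≤ amplitudePotential μ₀ β₂ K₀ K₂ A := by
  have hq : 0 ≤ -(K₀ * (A 0 ^ 4 + A 1 ^ 4 + A 2 ^ 4)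
      + 2 * K₂ * (A 0 ^ 2 * A 1 ^ 2 + A 1 ^ 2 * A 2 ^ 2 + A 2 ^ 2 * A 0 ^ 2)) := by
    by_cases hA : A = 0
    · simp [hA]
    · linarith [quartic_pos hK₀ hK₂ hA]
  have hS : 0 ≤ μ₀ * (A 0 ^ 2 + A 1 ^ 2 + A 2 ^ 2) := by positivity
  simp only [amplitudePotential, nehari, Pi.smul_apply, smul_eq_mul] at *
  -- With `M` and `Q` the quadratic and quartic parts of `N`, eliminating the cubic part gives `V(A)
  -- - V(sA) = (1-s)² ((1+2s) M / 6 - (1+2s+3s²) Q / 12)`, where `Q ≤ 0`.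
  have h1 : 0 ≤ (1 - s) ^ 2 * s := by positivity
  have h2 : 0 ≤ (1 - s) ^ 2 * (1 + 2 * s + 3 * s ^ 2) := by positivity
  have h3 := mul_nonneg h1 hS
  have h4 := mul_nonneg h2 hq
  linear_combination (exp := 1) h3 / 3 + h4 / 12 + (s ^ 3 - 1) / 3 * hN

end Potential

/-! ### Energy, dissipation and the potential well. -/

noncomputable section Energy

/-- The diffusion coefficient `4 (d · kⱼ)²` of the `j`-th amplitude. -/
def diffusionCoeff (θ : ℝ) (j : Fin 3) : ℝ := 4 * (frontDirection θ ⬝ᵥ hexGenerator j) ^ 2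

/-- The energy of the reduced system. -/
def reducedEnergy (θ μ₀ β₂ K₀ K₂ : ℝ) (p : (Fin 3 → ℝ) × (Fin 3 → ℝ)) : ℝ :=
  ∑ j, diffusionCoeff θ j / 2 * p.2 j ^ 2 + amplitudePotential μ₀ β₂ K₀ K₂ p.1

variable {θ c₀ μ₀ β₂ K₀ K₂ : ℝ}

/-- On this range of angles the front direction is orthogonal to no generator; at `θ = π / 6` it
becomes orthogonal to the second. -/
theorem diffusionCoeff_pos (hθ : θ ∈ Ioo 0 (π / 6)) (j : Fin 3) : 0 < diffusionCoeff θ j := by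
  obtain ⟨h0, h1⟩ := hθ
  have hpi := pi_pos
  have hs : 0 < sin θ := sin_pos_of_pos_of_lt_pi h0 (by linarith)
  have hs' : sin θ < 1 / 2 := by
    rw [← sin_pi_div_six]
    exact sin_lt_sin_of_lt_of_le_pi_div_two (by linarith) (by linarith) h1
  have hc : √3 / 2 < cos θ := by
    rw [← cos_pi_div_six]
    exact cos_lt_cos_of_nonneg_of_le_pi h0.le (by linarith) h1
  have h3 : (√3) ^ 2 = 3 := sq_sqrt (by norm_num)
  have h3' : 0 < √3 := by positivity
  have h31 : 1 < √3 := by nlinarith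
  have h : frontDirection θ ⬝ᵥ hexGenerator j ≠ 0 := by
    fin_cases j <;> simp [frontDirection, hexGenerator, dotProduct, Fin.sum_univ_two]
    · linarith
    · nlinarith
    · nlinarith
  unfold diffusionCoeff
  positivity

theorem reducedField_snd (p : (Fin 3 → ℝ) × (Fin 3 → ℝ)) (j : Fin 3) :
    (reducedField θ c₀ μ₀ β₂ K₀ K₂ p).2 j =
      -(amplitudeGradient μ₀ β₂ K₀ K₂ p.1 j + c₀ * p.2 j) / diffusionCoeff θ j := by
  simp only [reducedField, amplitudeGradient, diffusionCoeff]
  ring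

theorem contDiff_reducedField {n : WithTop ℕ∞} :
    ContDiff ℝ n (reducedField θ c₀ μ₀ β₂ K₀ K₂) := by
  unfold reducedField amplitudeNonlinearity
  simp only [sq_abs]
  refine contDiff_snd.prodMk (contDiff_pi.2 fun j => ?_)
  fun_prop

theorem contDiff_reducedEnergy {n : WithTop ℕ∞} :
    ContDiff ℝ n (reducedEnergy θ μ₀ β₂ K₀ K₂) := by
  unfold reducedEnergy
  exact (ContDiff.sum fun j _ => by fun_prop).add (contDiff_amplitudePotential.comp contDiff_fst)

theorem hasDerivAt_coord {u : ℝ → (Fin 3 → ℝ) × (Fin 3 → ℝ)} {v : (Fin 3 → ℝ) × (Fin 3 → ℝ)} {t : ℝ}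
    (hu : HasDerivAt u v t) (j : Fin 3) :
    HasDerivAt (fun s => (u s).1 j) (v.1 j) t ∧ HasDerivAt (fun s => (u s).2 j) (v.2 j) t :=
  ⟨hasDerivAt_pi.1 ((ContinuousLinearMap.fst ℝ (Fin 3 → ℝ) (Fin 3 → ℝ)).hasFDerivAt.comp_hasDerivAt
      t hu) j,
    hasDerivAt_pi.1 ((ContinuousLinearMap.snd ℝ (Fin 3 → ℝ) (Fin 3 → ℝ)).hasFDerivAt.comp_hasDerivAt
      t hu) j⟩

theorem hasDerivAt_reducedEnergy {u : ℝ → (Fin 3 → ℝ) × (Fin 3 → ℝ)}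
    {v : (Fin 3 → ℝ) × (Fin 3 → ℝ)} {t : ℝ} (hu : HasDerivAt u v t) :
    HasDerivAt (fun s => reducedEnergy θ μ₀ β₂ K₀ K₂ (u s))
      (∑ j, diffusionCoeff θ j * (u t).2 j * v.2 j
        + ∑ j, amplitudeGradient μ₀ β₂ K₀ K₂ (u t).1 j * v.1 j) t := by
  refine HasDerivAt.add ?_ (hasDerivAt_amplitudePotential fun j => (hasDerivAt_coord hu j).1)
  refine HasDerivAt.fun_sum fun j _ => ?_
  refine (((hasDerivAt_coord hu j).2.pow 2).const_mul (diffusionCoeff θ j / 2)).congr_deriv ?_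
  simp
  ring

/-- The weights `diffusionCoeff θ j` cancel the denominators of the field, after which the gradient
terms cancel and only friction remains. -/
theorem energy_dissipation (hθ : θ ∈ Ioo 0 (π / 6)) (p : (Fin 3 → ℝ) × (Fin 3 → ℝ)) :
    ∑ j, diffusionCoeff θ j * p.2 j * (reducedField θ c₀ μ₀ β₂ K₀ K₂ p).2 j
        + ∑ j, amplitudeGradient μ₀ β₂ K₀ K₂ p.1 j * (reducedField θ c₀ μ₀ β₂ K₀ K₂ p).1 j
      = -(c₀ * ∑ j, p.2 j ^ 2) := by
  rw [← Finset.sum_add_distrib, Finset.mul_sum, ← Finset.sum_neg_distrib]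
  refine Finset.sum_congr rfl fun j _ => ?_
  rw [reducedField_snd]
  have := (diffusionCoeff_pos hθ j).ne'
  simp only [reducedField]
  field_simp
  ring

theorem fderiv_reducedEnergy (hθ : θ ∈ Ioo 0 (π / 6)) (p : (Fin 3 → ℝ) × (Fin 3 → ℝ)) :
    fderiv ℝ (reducedEnergy θ μ₀ β₂ K₀ K₂) p (reducedField θ c₀ μ₀ β₂ K₀ K₂ p)
      = -(c₀ * ∑ j, p.2 j ^ 2) := by
  set v := reducedField θ c₀ μ₀ β₂ K₀ K₂ p with hv
  have hu : HasDerivAt (fun s : ℝ => p + s • v) v 0 := by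
    simpa using ((hasDerivAt_id (0 : ℝ)).smul_const v).const_add p
  have h1 := hasDerivAt_reducedEnergy (θ := θ) (μ₀ := μ₀) (β₂ := β₂) (K₀ := K₀) (K₂ := K₂) hu
  have h2 := ((contDiff_reducedEnergy (θ := θ) (μ₀ := μ₀) (β₂ := β₂) (K₀ := K₀) (K₂ := K₂)
    (n := 1)).differentiable one_ne_zero (p + (0 : ℝ) • v)).hasFDerivAt.comp_hasDerivAt 0 hu
  have h3 := h2.unique h1
  simp only [zero_smul, add_zero] at h3
  rw [h3, hv, energy_dissipation hθ]

theorem reducedField_eq_zero_iff (hθ : θ ∈ Ioo 0 (π / 6)) {p : (Fin 3 → ℝ) × (Fin 3 → ℝ)} :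
    reducedField θ c₀ μ₀ β₂ K₀ K₂ p = 0 ↔
      p.2 = 0 ∧ ∀ j, amplitudeGradient μ₀ β₂ K₀ K₂ p.1 j = 0 := by
  refine ⟨fun h => ?_, fun h => Prod.ext h.1 (funext fun j => ?_)⟩
  · have h2 : p.2 = 0 := congrArg Prod.fst h
    refine ⟨h2, fun j => ?_⟩
    have h1 : (reducedField θ c₀ μ₀ β₂ K₀ K₂ p).2 j = 0 := by rw [h]; rfl
    rw [reducedField_snd, h2] at h1
    simpa [(diffusionCoeff_pos hθ j).ne'] using h1
  · rw [reducedField_snd, h.1, h.2]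
    simp

/-- An orbit along which the energy is constant consists of equilibria. -/
theorem reducedField_eq_zero_of_energy_const (hθ : θ ∈ Ioo 0 (π / 6)) (hc₀ : 0 < c₀)
    {u : ℝ → (Fin 3 → ℝ) × (Fin 3 → ℝ)} {a b e : ℝ}
    (hu : ∀ t ∈ Ioo a b, HasDerivAt u (reducedField θ c₀ μ₀ β₂ K₀ K₂ (u t)) t)
    (he : ∀ t ∈ Ioo a b, reducedEnergy θ μ₀ β₂ K₀ K₂ (u t) = e) {t : ℝ} (ht : t ∈ Ioo a b) :
    reducedField θ c₀ μ₀ β₂ K₀ K₂ (u t) = 0 := by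
  have hB : ∀ s ∈ Ioo a b, ∀ j, (u s).2 j = 0 := by
    intro s hs j
    have h1 := hasDerivAt_reducedEnergy (θ := θ) (μ₀ := μ₀) (β₂ := β₂) (K₀ := K₀) (K₂ := K₂)
      (hu s hs)
    rw [energy_dissipation hθ] at h1
    have h2 : (fun s => reducedEnergy θ μ₀ β₂ K₀ K₂ (u s)) =ᶠ[𝓝 s] fun _ => e := by
      filter_upwards [Ioo_mem_nhds hs.1 hs.2] with r hr using he r hr
    have h3 := (h1.congr_of_eventuallyEq h2.symm).unique (hasDerivAt_const s e)
    have h4 : ∑ j, (u s).2 j ^ 2 = 0 := by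
      have := neg_eq_zero.1 h3
      exact (mul_eq_zero.1 this).resolve_left hc₀.ne'
    have h5 := (Finset.sum_eq_zero_iff_of_nonneg fun i _ => sq_nonneg ((u s).2 i)).1 h4 j
      (Finset.mem_univ j)
    exact pow_eq_zero_iff two_ne_zero |>.1 h5
  refine Prod.ext (funext (hB t ht)) (funext fun j => ?_)
  have h1 := (hasDerivAt_coord (hu t ht) j).2
  have h2 : (fun s => (u s).2 j) =ᶠ[𝓝 t] fun _ => 0 := by
    filter_upwards [Ioo_mem_nhds ht.1 ht.2] with r hr using hB r hr j
  exact (h1.congr_of_eventuallyEq h2.symm).unique (hasDerivAt_const t 0)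

theorem amplitudePotential_le_reducedEnergy (hθ : θ ∈ Ioo 0 (π / 6))
    (p : (Fin 3 → ℝ) × (Fin 3 → ℝ)) (j : Fin 3) :
    diffusionCoeff θ j / 2 * p.2 j ^ 2 + amplitudePotential μ₀ β₂ K₀ K₂ p.1
      ≤ reducedEnergy θ μ₀ β₂ K₀ K₂ p := by
  refine add_le_add_left (Finset.single_le_sum
    (f := fun j => diffusionCoeff θ j / 2 * p.2 j ^ 2) (fun i _ => ?_) (Finset.mem_univ j)) _
  have := diffusionCoeff_pos hθ i
  positivity

/-- Energy alone is not coercive, because `V` tends to `-∞` along rays. The Nehari constraint bounds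
`A`, hence `V` from below, and the energy bound then controls `B`. -/
theorem isCompact_reducedEnergy_le (hθ : θ ∈ Ioo 0 (π / 6)) (hμ : 0 < μ₀) (hK₀ : K₀ < 0)
    (hK₂ : K₂ < 0) (h : ℝ) :
    IsCompact {p : (Fin 3 → ℝ) × (Fin 3 → ℝ) |
      0 ≤ nehari μ₀ β₂ K₀ K₂ p.1 ∧ reducedEnergy θ μ₀ β₂ K₀ K₂ p ≤ h} := by
  have hcpt := isCompact_nehari_nonneg (β₂ := β₂) hμ hK₀ hK₂
  obtain ⟨C, hC⟩ := isBounded_iff_forall_norm_le.1 hcpt.isBounded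
  obtain ⟨m, hm⟩ := (hcpt.image (contDiff_amplitudePotential (μ₀ := μ₀) (β₂ := β₂) (K₀ := K₀)
    (K₂ := K₂) (n := 0)).continuous).bddBelow
  refine Metric.isCompact_of_isClosed_isBounded
    ((isClosed_le continuous_const ((contDiff_nehari (n := 0)).continuous.comp continuous_fst)).inter
      (isClosed_le (contDiff_reducedEnergy (n := 0)).continuous continuous_const)) ?_
  refine isBounded_iff_forall_norm_le.2
    ⟨max C (∑ j, √((h - m) / (diffusionCoeff θ j / 2))), fun p hp => ?_⟩
  refine norm_prod_le_iff.2 ⟨(hC _ hp.1).trans (le_max_left _ _), le_trans ?_ (le_max_right _ _)⟩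
  refine (pi_norm_le_iff_of_nonneg (Finset.sum_nonneg fun j _ => sqrt_nonneg _)).2 fun j => ?_
  refine le_trans ?_ (Finset.single_le_sum
    (f := fun j => √((h - m) / (diffusionCoeff θ j / 2))) (fun _ _ => sqrt_nonneg _)
    (Finset.mem_univ j))
  refine abs_le_sqrt ?_
  have h1 := amplitudePotential_le_reducedEnergy (μ₀ := μ₀) (β₂ := β₂) (K₀ := K₀) (K₂ := K₂) hθ p j
  have h2 := hm (mem_image_of_mem _ hp.1)
  rw [le_div_iff₀ (half_pos (diffusionCoeff_pos hθ j))]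
  linarith [hp.2]

/-- A minimiser of the potential on the Nehari manifold that is an isolated critical point is
connected to the trivial state. -/
theorem exists_isHeteroclinicOrbit_of_nehari_min (hθ : θ ∈ Ioo 0 (π / 6)) (hc₀ : 0 < c₀)
    (hμ : 0 < μ₀) (hK₀ : K₀ < 0) (hK₂ : K₂ < 0) {P : Fin 3 → ℝ} (hP : P ≠ 0)
    (hcrit : ∀ j, amplitudeGradient μ₀ β₂ K₀ K₂ P j = 0)
    (hmin : ∀ A, A ≠ 0 → nehari μ₀ β₂ K₀ K₂ A = 0 →
      amplitudePotential μ₀ β₂ K₀ K₂ P ≤ amplitudePotential μ₀ β₂ K₀ K₂ A)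
    (hiso : ∀ᶠ A in 𝓝 P, (∀ j, amplitudeGradient μ₀ β₂ K₀ K₂ A j = 0) → A = P) :
    ∃ u, IsHeteroclinicOrbit (reducedField θ c₀ μ₀ β₂ K₀ K₂) (P, 0) (0, 0) u := by
  have hNP := nehari_eq_zero_of_gradient hcrit
  have hSP := sq_sum_pos hP
  have hNcont : Continuous (nehari μ₀ β₂ K₀ K₂) := (contDiff_nehari (n := 0)).continuous
  have hEcont : Continuous (reducedEnergy θ μ₀ β₂ K₀ K₂) :=
    (contDiff_reducedEnergy (n := 0)).continuous
  have hE0 : ∀ A, reducedEnergy θ μ₀ β₂ K₀ K₂ (A, 0) = amplitudePotential μ₀ β₂ K₀ K₂ A := fun A => by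
    simp [reducedEnergy]
  have hray : ∀ s : ℝ, 0 ≤ s → s < 1 →
      amplitudePotential μ₀ β₂ K₀ K₂ (s • P) < amplitudePotential μ₀ β₂ K₀ K₂ P := fun s hs hs1 => by
    have h1 := amplitudePotential_smul_add_le hμ hK₀ hK₂ hNP hs
    have h2 : 0 < 1 - s := by linarith
    have h3 : 0 < μ₀ / 6 * (1 - s) ^ 2 * (P 0 ^ 2 + P 1 ^ 2 + P 2 ^ 2) := by positivity
    linarith
  set h := amplitudePotential μ₀ β₂ K₀ K₂ P with hh
  have hVE : ∀ p, amplitudePotential μ₀ β₂ K₀ K₂ p.1 ≤ reducedEnergy θ μ₀ β₂ K₀ K₂ p := fun p => by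
    have h1 := amplitudePotential_le_reducedEnergy (μ₀ := μ₀) (β₂ := β₂) (K₀ := K₀) (K₂ := K₂) hθ p 0
    have h2 := diffusionCoeff_pos hθ 0
    have h3 : 0 ≤ diffusionCoeff θ 0 / 2 * p.2 0 ^ 2 := by positivity
    linarith
  obtain ⟨r, hr, hball⟩ := Metric.eventually_nhds_iff.1 hiso
  obtain ⟨δ, hδ, hpos⟩ := exists_nehari_pos (β₂ := β₂) hμ hK₀ hK₂
  refine exists_isHeteroclinicOrbit_of_lyapunov contDiff_reducedField
    ((contDiff_reducedEnergy (n := 1)).differentiable one_ne_zero) (fun x => ?_)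
    (fun u a b e hu he t ht => reducedField_eq_zero_of_energy_const hθ hc₀ hu he ht)
    (isCompact_reducedEnergy_le (β₂ := β₂) hθ hμ hK₀ hK₂ h) ?_ ((reducedField_eq_zero_iff hθ).2 ⟨rfl, hcrit⟩)
    (hE0 P) ?_ ((reducedField_eq_zero_iff hθ).2 ⟨rfl, fun j => by
      simp [amplitudeGradient, amplitudeNonlinearity]⟩) ?_ ?_ (half_pos hr) ?_
  · rw [fderiv_reducedEnergy hθ, neg_nonpos]
    exact mul_nonneg hc₀.le (Finset.sum_nonneg fun j _ => sq_nonneg _)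
  · refine isOpen_iff_mem_nhds.2 fun x hx => ?_
    have h1 : ∀ᶠ y in 𝓝 x, reducedEnergy θ μ₀ β₂ K₀ K₂ y < h :=
      hEcont.continuousAt.eventually_lt_const hx.2
    -- The constraint is never active away from `A = 0`: `N = 0` would give `V ≥ h`, contradicting
    -- `V ≤ E < h`. At `A = 0` it holds nearby by `exists_nehari_pos`.
    have h2 : ∀ᶠ y : (Fin 3 → ℝ) × (Fin 3 → ℝ) in 𝓝 x, 0 ≤ nehari μ₀ β₂ K₀ K₂ y.1 := by
      by_cases hx0 : x.1 = 0
      · have hc : Continuous fun y : (Fin 3 → ℝ) × (Fin 3 → ℝ) =>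
            y.1 0 ^ 2 + y.1 1 ^ 2 + y.1 2 ^ 2 := by fun_prop
        have h3 : ∀ᶠ y : (Fin 3 → ℝ) × (Fin 3 → ℝ) in 𝓝 x,
            y.1 0 ^ 2 + y.1 1 ^ 2 + y.1 2 ^ 2 < δ :=
          hc.continuousAt.eventually_lt_const (by simpa [hx0] using hδ)
        filter_upwards [h3] with y hy
        by_cases hy0 : y.1 = 0
        · simp [hy0, nehari]
        · exact (hpos _ hy0 hy).le
      · have h3 : 0 < nehari μ₀ β₂ K₀ K₂ x.1 := by
          refine lt_of_le_of_ne hx.1.1 fun h3 => ?_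
          linarith [hmin _ hx0 h3.symm, hVE x, hx.2]
        exact ((hNcont.comp continuous_fst).continuousAt.eventually_const_lt h3).mono
          fun y hy => le_of_lt hy
    filter_upwards [h1, h2] with y h3 h4 using ⟨⟨h4, h3.le⟩, h3⟩
  -- The points `sP` with `s ↑ 1` approach `P` from inside the well, since `N(sP) = s²(1-s) M -
  -- s³(1-s) Q > 0`.
  · have hc : Continuous fun s : ℝ => ((s • P, 0) : (Fin 3 → ℝ) × (Fin 3 → ℝ)) := by fun_prop
    have h1 : Tendsto (fun s : ℝ => ((s • P, 0) : (Fin 3 → ℝ) × (Fin 3 → ℝ))) (𝓝[<] 1)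
        (𝓝 (P, 0)) := by
      simpa using (hc.tendsto 1).mono_left nhdsWithin_le_nhds
    refine mem_closure_of_tendsto h1 ?_
    filter_upwards [self_mem_nhdsWithin, mem_nhdsWithin_of_mem_nhds (lt_mem_nhds one_pos)]
      with s hs1 hs0
    have h2 := hray s hs0.le hs1
    refine ⟨⟨?_, (hE0 _).trans_le h2.le⟩, (hE0 _).trans_lt h2⟩
    have h3 := quartic_pos hK₀ hK₂ hP
    have h4 : 0 < 1 - s := sub_pos.2 hs1
    simp only [nehari, Pi.smul_apply, smul_eq_mul] at hNP ⊢
    have h5 := mul_nonneg (by positivity : 0 ≤ s ^ 2 * (1 - s)) (mul_pos hμ hSP).le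
    have h6 := mul_nonneg (by positivity : 0 ≤ s ^ 3 * (1 - s)) (neg_pos.2 h3).le
    linear_combination (exp := 1) h5 + h6 - s ^ 3 * hNP
  · have h1 := hray 0 le_rfl one_pos
    rw [zero_smul] at h1
    exact (hE0 0).trans_lt h1
  · intro x hx hxh hFx
    obtain ⟨h1, h2⟩ := (reducedField_eq_zero_iff hθ).1 hFx
    refine Prod.ext ?_ h1
    by_contra hx0
    linarith [hmin _ hx0 (nehari_eq_zero_of_gradient h2), hVE x]
  · intro x _ hxr hFx
    obtain ⟨h1, h2⟩ := (reducedField_eq_zero_iff hθ).1 hFx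
    refine Prod.ext (hball ?_ h2) h1
    have h3 : dist x.1 P ≤ dist x (P, 0) := by
      rw [Prod.dist_eq]; exact le_max_left _ _
    linarith

end Energy

/-! ### Minimisers on the Nehari manifold and isolated critical points. -/

section NehariMinimum

variable {μ₀ β₂ K₀ K₂ : ℝ} {A : Fin 3 → ℝ}

theorem fderiv_amplitudePotential (v : Fin 3 → ℝ) :
    fderiv ℝ (amplitudePotential μ₀ β₂ K₀ K₂) A v
      = ∑ j, amplitudeGradient μ₀ β₂ K₀ K₂ A j * v j := by
  have hu : HasDerivAt (fun s : ℝ => A + s • v) v 0 := by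
    simpa using ((hasDerivAt_id (0 : ℝ)).smul_const v).const_add A
  have h1 := hasDerivAt_amplitudePotential (μ₀ := μ₀) (β₂ := β₂) (K₀ := K₀) (K₂ := K₂)
    (hasDerivAt_pi.1 hu)
  have h2 := ((contDiff_amplitudePotential (μ₀ := μ₀) (β₂ := β₂) (K₀ := K₀) (K₂ := K₂)
    (n := 1)).differentiable one_ne_zero (A + (0 : ℝ) • v)).hasFDerivAt.comp_hasDerivAt 0 hu
  simpa using h2.unique h1

/-- On the ray `N(sA) = s²M + s³C + s⁴Q`, and `2M + 3C + 4Q = Q - M` when `N(A) = 0`. This is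
negative for `μ₀ > 0`, `K₀, K₂ < 0` and `A ≠ 0`, so rays cross the manifold transversally. -/
theorem fderiv_nehari_self (hN : nehari μ₀ β₂ K₀ K₂ A = 0) :
    fderiv ℝ (nehari μ₀ β₂ K₀ K₂) A A = K₀ * (A 0 ^ 4 + A 1 ^ 4 + A 2 ^ 4)
      + 2 * K₂ * (A 0 ^ 2 * A 1 ^ 2 + A 1 ^ 2 * A 2 ^ 2 + A 2 ^ 2 * A 0 ^ 2)
      - μ₀ * (A 0 ^ 2 + A 1 ^ 2 + A 2 ^ 2) := by
  have hu : HasDerivAt (fun s : ℝ => s • A) A 1 := by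
    simpa using (hasDerivAt_id (1 : ℝ)).smul_const A
  have h2 := ((contDiff_nehari (μ₀ := μ₀) (β₂ := β₂) (K₀ := K₀) (K₂ := K₂)
    (n := 1)).differentiable one_ne_zero ((1 : ℝ) • A)).hasFDerivAt.comp_hasDerivAt 1 hu
  have h1 : HasDerivAt (fun s : ℝ => s ^ 2 * (μ₀ * (A 0 ^ 2 + A 1 ^ 2 + A 2 ^ 2))
      + s ^ 3 * (3 * β₂ * (A 0 * A 1 * A 2)) + s ^ 4 * (K₀ * (A 0 ^ 4 + A 1 ^ 4 + A 2 ^ 4)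
      + 2 * K₂ * (A 0 ^ 2 * A 1 ^ 2 + A 1 ^ 2 * A 2 ^ 2 + A 2 ^ 2 * A 0 ^ 2))) _ 1 :=
    (((hasDerivAt_pow 2 (1 : ℝ)).mul_const _).add ((hasDerivAt_pow 3 (1 : ℝ)).mul_const _)).add
      ((hasDerivAt_pow 4 (1 : ℝ)).mul_const _)
  have h3 : (nehari μ₀ β₂ K₀ K₂ ∘ fun s : ℝ => s • A) =
      (fun s : ℝ => s ^ 2 * (μ₀ * (A 0 ^ 2 + A 1 ^ 2 + A 2 ^ 2))
      + s ^ 3 * (3 * β₂ * (A 0 * A 1 * A 2)) + s ^ 4 * (K₀ * (A 0 ^ 4 + A 1 ^ 4 + A 2 ^ 4)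
      + 2 * K₂ * (A 0 ^ 2 * A 1 ^ 2 + A 1 ^ 2 * A 2 ^ 2 + A 2 ^ 2 * A 0 ^ 2))) := by
    ext s
    simp only [Function.comp_apply, nehari, Pi.smul_apply, smul_eq_mul]
    ring
  rw [h3] at h2
  have h4 := h2.unique h1
  rw [one_smul] at h4
  rw [h4]
  unfold nehari at hN
  norm_num
  linarith

/-- The Nehari manifold is a natural constraint: a constrained minimiser is a critical point. -/
theorem amplitudeGradient_eq_zero_of_nehari_min (hμ : 0 < μ₀) (hK₀ : K₀ < 0) (hK₂ : K₂ < 0)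
    (hA : A ≠ 0) (hN : nehari μ₀ β₂ K₀ K₂ A = 0)
    (hmin : ∀ B, B ≠ 0 → nehari μ₀ β₂ K₀ K₂ B = 0 →
      amplitudePotential μ₀ β₂ K₀ K₂ A ≤ amplitudePotential μ₀ β₂ K₀ K₂ B) (j : Fin 3) :
    amplitudeGradient μ₀ β₂ K₀ K₂ A j = 0 := by
  have hext : IsLocalExtrOn (amplitudePotential μ₀ β₂ K₀ K₂)
      {B | nehari μ₀ β₂ K₀ K₂ B = nehari μ₀ β₂ K₀ K₂ A} A := by
    refine Or.inl ?_
    filter_upwards [self_mem_nhdsWithin, mem_nhdsWithin_of_mem_nhds (isOpen_ne.mem_nhds hA)]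
      with B hB hB0
    exact hmin B hB0 (hB.trans hN)
  obtain ⟨a, b, hab, h⟩ := hext.exists_multipliers_of_hasStrictFDerivAt_1d
    ((contDiff_nehari (n := 1)).contDiffAt.hasStrictFDerivAt one_ne_zero)
    ((contDiff_amplitudePotential (n := 1)).contDiffAt.hasStrictFDerivAt one_ne_zero)
  -- Testing the multiplier identity on `A` itself removes the `V` term, as `∇V · A = N = 0`;
  -- transversality then kills the multiplier of `N`.
  have hA' := DFunLike.congr_fun h A
  have hsum : ∑ j, amplitudeGradient μ₀ β₂ K₀ K₂ A j * A j = 0 := by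
    rw [← hN, nehari_eq_sum]
    exact Finset.sum_congr rfl fun _ _ => mul_comm _ _
  simp only [_root_.add_apply, _root_.smul_apply,
    fderiv_amplitudePotential, fderiv_nehari_self hN, hsum, smul_eq_mul, mul_zero, add_zero,
    _root_.zero_apply] at hA'
  have hlt := quartic_pos hK₀ hK₂ hA
  have hS := mul_pos hμ (sq_sum_pos hA)
  have ha : a = 0 := (mul_eq_zero.1 hA').resolve_right (by linarith)
  have hb : b ≠ 0 := fun hb => hab (by rw [ha, hb]; rfl)
  have hj := DFunLike.congr_fun h (Pi.single j 1)
  simpa [ha, hb, fderiv_amplitudePotential, Pi.single_apply] using hj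

/-- A lower bound of the potential at all nontrivial critical points holds on the whole Nehari
manifold. -/
theorem le_amplitudePotential_of_critical (hμ : 0 < μ₀) (hK₀ : K₀ < 0) (hK₂ : K₂ < 0) {c : ℝ}
    (hc : ∀ B, B ≠ 0 → (∀ j, amplitudeGradient μ₀ β₂ K₀ K₂ B j = 0) →
      c ≤ amplitudePotential μ₀ β₂ K₀ K₂ B)
    (hA : A ≠ 0) (hN : nehari μ₀ β₂ K₀ K₂ A = 0) : c ≤ amplitudePotential μ₀ β₂ K₀ K₂ A := by
  obtain ⟨δ, hδ, hpos⟩ := exists_nehari_pos (β₂ := β₂) hμ hK₀ hK₂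
  have hNc : Continuous (nehari μ₀ β₂ K₀ K₂) := (contDiff_nehari (n := 0)).continuous
  have hSc : Continuous fun B : Fin 3 → ℝ => B 0 ^ 2 + B 1 ^ 2 + B 2 ^ 2 := by fun_prop
  -- Nonzero Nehari points stay at distance from the origin, so the minimum over them is attained.
  have hsub : ∀ B, B ≠ 0 → nehari μ₀ β₂ K₀ K₂ B = 0 →
      B ∈ {B | 0 ≤ nehari μ₀ β₂ K₀ K₂ B} ∩
        ({B | nehari μ₀ β₂ K₀ K₂ B = 0} ∩ {B | δ ≤ B 0 ^ 2 + B 1 ^ 2 + B 2 ^ 2}) :=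
    fun B hB0 hB => ⟨hB.ge, hB, not_lt.1 fun hlt => (hpos B hB0 hlt).ne' hB⟩
  obtain ⟨P, hP, hPmin⟩ := ((isCompact_nehari_nonneg (β₂ := β₂) hμ hK₀ hK₂).inter_right
    ((isClosed_eq hNc continuous_const).inter (isClosed_le continuous_const hSc))).exists_isMinOn
    ⟨A, hsub A hA hN⟩
    (contDiff_amplitudePotential (μ₀ := μ₀) (β₂ := β₂) (K₀ := K₀) (K₂ := K₂)
      (n := 0)).continuous.continuousOn
  have hP0 : P ≠ 0 := by
    rintro rfl
    have : δ ≤ 0 := by simpa using hP.2.2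
    linarith
  have hmin : ∀ B, B ≠ 0 → nehari μ₀ β₂ K₀ K₂ B = 0 →
      amplitudePotential μ₀ β₂ K₀ K₂ P ≤ amplitudePotential μ₀ β₂ K₀ K₂ B :=
    fun B hB0 hB => hPmin (hsub B hB0 hB)
  exact (hc P hP0 (amplitudeGradient_eq_zero_of_nehari_min hμ hK₀ hK₂ hP0 hP.2.1 hmin)).trans
    (hmin A hA hN)

/-- The quartic part cancels in `4V - N`, so critical values can be compared through quadratic and
cubic terms only. -/
theorem four_mul_amplitudePotential (hN : nehari μ₀ β₂ K₀ K₂ A = 0) :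
    4 * amplitudePotential μ₀ β₂ K₀ K₂ A =
      μ₀ * (A 0 ^ 2 + A 1 ^ 2 + A 2 ^ 2) + β₂ * (A 0 * A 1 * A 2) := by
  unfold amplitudePotential
  unfold nehari at hN
  linear_combination hN

/-- On critical points of mixed-mode type the potential is at least its value at the roll waves.
Here `X`, `Y`, `Y` are the squared amplitudes and `T` is the value of the cubic term. -/
theorem roll_energy_le_mixed (hK : K₀ < K₂) (hK₂ : K₂ < 0) {X Y T : ℝ}
    (h1 : μ₀ + K₀ * (X + Y) + K₂ * Y = 0) (h2 : μ₀ * X + T + K₀ * X ^ 2 + K₂ * X * (Y + Y) = 0) :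
    μ₀ ^ 2 ≤ -K₀ * (μ₀ * (X + Y + Y) + T) := by
  have h3 : μ₀ = -K₀ * (X + Y) - K₂ * Y := by linarith
  have h4 : T = -(μ₀ * X) - K₀ * X ^ 2 - K₂ * X * (Y + Y) := by linarith
  have h5 : 0 ≤ (K₂ - K₀) * (-(K₀ + K₂)) * Y ^ 2 :=
    mul_nonneg (mul_nonneg (by linarith) (by linarith)) (sq_nonneg Y)
  -- After eliminating `T` and `μ₀`, the difference of the two sides is exactly the product in `h5`.
  subst h4
  subst h3
  linarith

/-- The potential energy of the down-hexagons `(-α, -α, -α)`. -/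
theorem amplitudePotential_hexagons {α : ℝ} (hα : μ₀ = β₂ * α - (K₀ + 2 * K₂) * α ^ 2) :
    4 * amplitudePotential μ₀ β₂ K₀ K₂ (fun _ => -α) = α ^ 2 * (3 * μ₀ - β₂ * α) := by
  simp only [amplitudePotential]
  subst hα
  ring

theorem amplitudeGradient_hexagons {α : ℝ} (hα : μ₀ = β₂ * α - (K₀ + 2 * K₂) * α ^ 2) (j : Fin 3) :
    amplitudeGradient μ₀ β₂ K₀ K₂ (fun _ => -α) j = 0 := by
  simp only [amplitudeGradient, amplitudeNonlinearity, sq_abs]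
  subst hα
  ring

/-- The right-hand side is strictly increasing in the amplitude on the positive axis. -/
theorem hexagon_amplitude_unique (hβ₂ : 0 ≤ β₂) (hK : K₀ + 2 * K₂ < 0) {α t : ℝ} (hα0 : 0 < α)
    (hα : μ₀ = β₂ * α - (K₀ + 2 * K₂) * α ^ 2) (ht0 : 0 < t)
    (ht : μ₀ = β₂ * t - (K₀ + 2 * K₂) * t ^ 2) : t = α := by
  have h1 : (t - α) * (β₂ + -(K₀ + 2 * K₂) * (t + α)) = 0 := by linear_combination hα - ht
  have h2 : 0 < β₂ + -(K₀ + 2 * K₂) * (t + α) :=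
    add_pos_of_nonneg_of_pos hβ₂ (mul_pos (by linarith) (by linarith))
  linarith [(mul_eq_zero.1 h1).resolve_right h2.ne']

/-- For `K₂ < K₀` the down-hexagons minimise the potential on the Nehari manifold. -/
theorem hexagons_le_amplitudePotential (hμ : 0 < μ₀) (hβ₂ : 0 ≤ β₂) (hK₀ : K₀ < 0)
    (hK : K₂ < K₀) {α : ℝ} (hα0 : 0 < α) (hα : μ₀ = β₂ * α - (K₀ + 2 * K₂) * α ^ 2)
    (hA : A ≠ 0) (hN : nehari μ₀ β₂ K₀ K₂ A = 0) :
    amplitudePotential μ₀ β₂ K₀ K₂ (fun _ => -α) ≤ amplitudePotential μ₀ β₂ K₀ K₂ A := by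
  have hS := sq_sum_pos hA
  have hP := sq_prod_le_cube_sum_sq (A 0) (A 1) (A 2)
  obtain ⟨t, ht, htS⟩ : ∃ t > 0, A 0 ^ 2 + A 1 ^ 2 + A 2 ^ 2 = 3 * t ^ 2 :=
    ⟨√((A 0 ^ 2 + A 1 ^ 2 + A 2 ^ 2) / 3), by positivity, by
      rw [sq_sqrt (by positivity)]; ring⟩
  -- At fixed sum of squares `3t²`, both the product and the quartic form are smallest at `(-t, -t,
  -- -t)`; for the latter this is where `K₂ < K₀` enters.
  have hP' : -t ^ 3 ≤ A 0 * A 1 * A 2 := by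
    refine (abs_le.1 (abs_le_of_sq_le_sq ?_ (by positivity))).1
    rw [htS] at hP
    linarith
  have hQ : (K₀ + 2 * K₂) * (3 * t ^ 4) ≤ K₀ * (A 0 ^ 4 + A 1 ^ 4 + A 2 ^ 4)
      + 2 * K₂ * (A 0 ^ 2 * A 1 ^ 2 + A 1 ^ 2 * A 2 ^ 2 + A 2 ^ 2 * A 0 ^ 2) := by
    have h1 : 0 ≤ (K₀ - K₂) * ((A 0 ^ 2 - A 1 ^ 2) ^ 2 + (A 1 ^ 2 - A 2 ^ 2) ^ 2
        + (A 2 ^ 2 - A 0 ^ 2) ^ 2) := mul_nonneg (by linarith) (by positivity)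
    have h2 : 9 * t ^ 4 = (A 0 ^ 2 + A 1 ^ 2 + A 2 ^ 2) ^ 2 := by rw [htS]; ring
    linear_combination (exp := 1) h1 / 3 + (K₀ + 2 * K₂) / 3 * h2
  -- Rescaling matches the norm of the hexagons, and moving along the ray away from the Nehari point
  -- only lowers `V`.
  obtain ⟨s, hs, hst⟩ : ∃ s > 0, s * t = α := ⟨α / t, by positivity, by field_simp⟩
  have h1 := amplitudePotential_smul_add_le hμ hK₀ (hK.trans hK₀) hN hs.le
  have h2 : 0 ≤ μ₀ / 6 * (1 - s) ^ 2 * (A 0 ^ 2 + A 1 ^ 2 + A 2 ^ 2) := by positivity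
  have h3 : amplitudePotential μ₀ β₂ K₀ K₂ (fun _ => -α)
      ≤ amplitudePotential μ₀ β₂ K₀ K₂ (s • A) := by
    have h4 := mul_le_mul_of_nonneg_left hP' (by positivity : 0 ≤ β₂ * s ^ 3)
    have h5 := mul_le_mul_of_nonneg_left hQ (by positivity : 0 ≤ s ^ 4 / 4)
    have h6 := congrArg (fun x => μ₀ / 2 * s ^ 2 * x) htS
    simp only [amplitudePotential, Pi.smul_apply, smul_eq_mul]
    subst hst
    linarith
  linarith

/-- For `K₀ < K₂` the potential on the Nehari manifold is bounded below by its values at the roll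
waves and at the down-hexagons. -/
theorem le_amplitudePotential_of_le_roll_of_le_hexagons (hμ : 0 < μ₀) (hβ₂ : 0 ≤ β₂) (hK₂ : K₂ < 0)
    (hK : K₀ < K₂) {α : ℝ} (hα0 : 0 < α) (hα : μ₀ = β₂ * α - (K₀ + 2 * K₂) * α ^ 2) {c : ℝ}
    (hcR : -K₀ * (4 * c) ≤ μ₀ ^ 2)
    (hcH : c ≤ amplitudePotential μ₀ β₂ K₀ K₂ (fun _ => -α))
    (hA : A ≠ 0) (hN : nehari μ₀ β₂ K₀ K₂ A = 0) : c ≤ amplitudePotential μ₀ β₂ K₀ K₂ A := by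
  have hK₀ : K₀ < 0 := hK.trans hK₂
  refine le_amplitudePotential_of_critical hμ hK₀ hK₂ (fun B hB hcrit => ?_) hA hN
  have hNB := nehari_eq_zero_of_gradient hcrit
  have hV := four_mul_amplitudePotential hNB
  have hroll : μ₀ ^ 2 ≤ -K₀ * (4 * amplitudePotential μ₀ β₂ K₀ K₂ B) →
      c ≤ amplitudePotential μ₀ β₂ K₀ K₂ B := fun h => by
    have := le_of_mul_le_mul_left (hcR.trans h) (neg_pos.2 hK₀)
    linarith
  have hS := sq_sum_pos hB
  rcases le_or_gt 0 (B 0 * B 1 * B 2) with hP | hP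
  -- With nonnegative product, `N = 0` forces `μ₀ ≤ -K₀ S`, so `4V ≥ μ₀ S ≥ μ₀² / (-K₀)`.
  · refine hroll ?_
    have hP' := mul_nonneg hβ₂ hP
    have h22 : 0 ≤ (K₂ - K₀) * (B 0 ^ 2 * B 1 ^ 2 + B 1 ^ 2 * B 2 ^ 2 + B 2 ^ 2 * B 0 ^ 2) :=
      mul_nonneg (by linarith) (by positivity)
    have h1 : μ₀ ≤ -K₀ * (B 0 ^ 2 + B 1 ^ 2 + B 2 ^ 2) := by
      refine le_of_mul_le_mul_right ?_ hS
      unfold nehari at hNB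
      linarith
    have h2 := mul_le_mul_of_nonneg_left h1 hμ.le
    have h3 := mul_nonneg (neg_pos.2 hK₀).le hP'
    rw [hV]
    linarith
  · have g0 := hcrit 0
    have g1 := hcrit 1
    have g2 := hcrit 2
    rw [amplitudeGradient_zero] at g0
    rw [amplitudeGradient_one] at g1
    rw [amplitudeGradient_two] at g2
    -- Multiplying by the amplitude makes the cubic term common to all three equations; their
    -- differences factor in the squared amplitudes.
    have e0 : μ₀ * B 0 ^ 2 + β₂ * (B 0 * B 1 * B 2) + K₀ * (B 0 ^ 2) ^ 2
        + K₂ * B 0 ^ 2 * (B 1 ^ 2 + B 2 ^ 2) = 0 := by linear_combination B 0 * g0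
    have e1 : μ₀ * B 1 ^ 2 + β₂ * (B 0 * B 1 * B 2) + K₀ * (B 1 ^ 2) ^ 2
        + K₂ * B 1 ^ 2 * (B 2 ^ 2 + B 0 ^ 2) = 0 := by linear_combination B 1 * g1
    have e2 : μ₀ * B 2 ^ 2 + β₂ * (B 0 * B 1 * B 2) + K₀ * (B 2 ^ 2) ^ 2
        + K₂ * B 2 ^ 2 * (B 0 ^ 2 + B 1 ^ 2) = 0 := by linear_combination B 2 * g2
    have f01 : B 0 ^ 2 = B 1 ^ 2 ∨ μ₀ + K₀ * (B 0 ^ 2 + B 1 ^ 2) + K₂ * B 2 ^ 2 = 0 := by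
      rw [← sub_eq_zero, ← mul_eq_zero]; linear_combination e0 - e1
    have f12 : B 1 ^ 2 = B 2 ^ 2 ∨ μ₀ + K₀ * (B 1 ^ 2 + B 2 ^ 2) + K₂ * B 0 ^ 2 = 0 := by
      rw [← sub_eq_zero, ← mul_eq_zero]; linear_combination e1 - e2
    have f20 : B 2 ^ 2 = B 0 ^ 2 ∨ μ₀ + K₀ * (B 2 ^ 2 + B 0 ^ 2) + K₂ * B 1 ^ 2 = 0 := by
      rw [← sub_eq_zero, ← mul_eq_zero]; linear_combination e2 - e0
    rw [hV] at hroll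
    generalize hT : β₂ * (B 0 * B 1 * B 2) = T at *
    by_cases h01 : B 0 ^ 2 = B 1 ^ 2
    · by_cases h12 : B 1 ^ 2 = B 2 ^ 2
      · refine hcH.trans (le_of_eq ?_)
        obtain ⟨t, ht, hts⟩ : ∃ t > 0, B 0 ^ 2 = t ^ 2 := by
          refine ⟨|B 0|, abs_pos.2 fun h0 => ?_, (sq_abs _).symm⟩
          simp [h0] at hP
        have ht1 : B 1 ^ 2 = t ^ 2 := h01 ▸ hts
        have ht2 : B 2 ^ 2 = t ^ 2 := h12 ▸ ht1
        have hPt : B 0 * B 1 * B 2 = -t ^ 3 := by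
          have h : (B 0 * B 1 * B 2 - t ^ 3) * (B 0 * B 1 * B 2 + t ^ 3) = 0 := by
            have : (B 0 * B 1 * B 2) ^ 2 = t ^ 2 * t ^ 2 * t ^ 2 := by
              rw [mul_pow, mul_pow, hts, ht1, ht2]
            linear_combination this
          have h' : B 0 * B 1 * B 2 - t ^ 3 < 0 := by
            have := pow_pos ht 3
            linarith
          linarith [(mul_eq_zero.1 h).resolve_left h'.ne]
        rw [hPt] at hT
        have hta : t = α := by
          refine hexagon_amplitude_unique hβ₂ (by linarith) hα0 hα ht ?_
          rw [hts, ht1, ht2, ← hT] at e0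
          refine sub_eq_zero.1 ((mul_eq_zero.1 ?_).resolve_left (pow_pos ht 2).ne')
          linear_combination e0
        have hVH := amplitudePotential_hexagons hα
        rw [hts, ht1, ht2, ← hT, hta] at hV
        linarith
      · have f := f12.resolve_left h12
        refine hroll ?_
        have := roll_energy_le_mixed (μ₀ := μ₀) (T := T) (X := B 2 ^ 2) (Y := B 1 ^ 2) hK hK₂
          (by rw [← h01] at f ⊢; linarith) (by rw [h01] at e2; linarith)
        rw [h01]; linarith
    · have f := f01.resolve_left h01
      rcases f12 with h12 | f12
      · refine hroll ?_
        have := roll_energy_le_mixed (μ₀ := μ₀) (T := T) (X := B 0 ^ 2) (Y := B 1 ^ 2) hK hK₂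
          (by rw [← h12] at f; linarith) (by rw [← h12] at e0; linarith)
        rw [← h12]; linarith
      · rcases f20 with h20 | f20
        · refine hroll ?_
          have := roll_energy_le_mixed (μ₀ := μ₀) (T := T) (X := B 1 ^ 2) (Y := B 0 ^ 2) hK hK₂
            (by rw [h20] at f; linarith) (by rw [h20] at e1; linarith)
          rw [h20]; linarith
        -- Three pairwise distinct squares are impossible: two of the linear relations differ by
        -- `(K₂ - K₀)(B 0 ^ 2 - B 1 ^ 2)`.
        · exfalso
          apply h01
          have h : (K₂ - K₀) * (B 0 ^ 2 - B 1 ^ 2) = 0 := by linarith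
          linarith [(mul_eq_zero.1 h).resolve_left (by linarith)]

/-- The down-hexagons are an isolated critical point away from the mixed-mode bifurcation. -/
theorem eventually_eq_hexagons (hβ₂ : 0 ≤ β₂) (hK : K₀ + 2 * K₂ < 0) {α : ℝ} (hα0 : 0 < α)
    (hα : μ₀ = β₂ * α - (K₀ + 2 * K₂) * α ^ 2) (hαβ : (K₂ - K₀) * α < β₂) :
    ∀ᶠ A in 𝓝 (fun _ : Fin 3 => -α), (∀ j, amplitudeGradient μ₀ β₂ K₀ K₂ A j = 0) →
      A = fun _ => -α := by
  have hpos : 0 < 2 * α * (β₂ - (K₂ - K₀) * α) := mul_pos (by linarith) (by linarith)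
  have c0 : ∀ᶠ A : Fin 3 → ℝ in 𝓝 (fun _ : Fin 3 => -α), A 0 < 0 :=
    (continuous_apply 0).continuousAt.eventually_lt_const (by simpa using hα0)
  -- This is the cofactor of `A 0 - A 1` in the difference of the first two gradient components; at
  -- the hexagons it equals `2α(β₂ - (K₂ - K₀)α)`.
  have c1 : ∀ᶠ A : Fin 3 → ℝ in 𝓝 (fun _ : Fin 3 => -α),
      0 < μ₀ - β₂ * A 2 + K₀ * (A 0 ^ 2 + A 0 * A 1 + A 1 ^ 2) + K₂ * (A 2 ^ 2 - A 0 * A 1) := by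
    refine Continuous.continuousAt (by fun_prop) |>.eventually_const_lt ?_
    refine hpos.trans_le (le_of_eq ?_)
    rw [hα]; ring
  have c2 : ∀ᶠ A : Fin 3 → ℝ in 𝓝 (fun _ : Fin 3 => -α),
      0 < μ₀ - β₂ * A 0 + K₀ * (A 1 ^ 2 + A 1 * A 2 + A 2 ^ 2) + K₂ * (A 0 ^ 2 - A 1 * A 2) := by
    refine Continuous.continuousAt (by fun_prop) |>.eventually_const_lt ?_
    refine hpos.trans_le (le_of_eq ?_)
    rw [hα]; ring
  filter_upwards [c0, c1, c2] with A h0 h1 h2 hcrit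
  have g0 := hcrit 0
  have g1 := hcrit 1
  have g2 := hcrit 2
  rw [amplitudeGradient_zero] at g0
  rw [amplitudeGradient_one] at g1
  rw [amplitudeGradient_two] at g2
  have e01 : A 0 = A 1 := by
    refine sub_eq_zero.1 ((mul_eq_zero.1 ?_).resolve_right h1.ne')
    linear_combination g0 - g1
  have e12 : A 1 = A 2 := by
    refine sub_eq_zero.1 ((mul_eq_zero.1 ?_).resolve_right h2.ne')
    linear_combination g1 - g2
  have ht := hexagon_amplitude_unique (t := -A 0) hβ₂ hK hα0 hα (by linarith) (by
    rw [← e12, ← e01] at g0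
    refine sub_eq_zero.1 ((mul_eq_zero.1 ?_).resolve_left h0.ne)
    linear_combination g0)
  ext j
  fin_cases j <;> simp <;> linarith

/-- The roll waves are an isolated critical point away from the mixed-mode bifurcation. -/
theorem eventually_eq_roll (hK₀ : K₀ < 0) {ρ : ℝ} (hρ0 : ρ ≠ 0)
    (hρ : μ₀ + K₀ * ρ ^ 2 = 0) (hdet : β₂ ^ 2 * ρ ^ 2 < (μ₀ + K₂ * ρ ^ 2) ^ 2) :
    ∀ᶠ A in 𝓝 ![ρ, 0, 0], (∀ j, amplitudeGradient μ₀ β₂ K₀ K₂ A j = 0) → A = ![ρ, 0, 0] := by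
  have c0 : ∀ᶠ A : Fin 3 → ℝ in 𝓝 ![ρ, 0, 0], 0 < ρ * A 0 := by
    refine Continuous.continuousAt (by fun_prop) |>.eventually_const_lt ?_
    simpa using mul_self_pos.2 hρ0
  -- The last two equations are linear in `(A 1, A 2)` with this determinant once the diagonal
  -- brackets are treated as coefficients; Cramer's rule gives `A 1 = A 2 = 0`.
  have c1 : ∀ᶠ A : Fin 3 → ℝ in 𝓝 ![ρ, 0, 0],
      0 < (μ₀ + K₀ * A 1 ^ 2 + K₂ * (A 2 ^ 2 + A 0 ^ 2))
        * (μ₀ + K₀ * A 2 ^ 2 + K₂ * (A 0 ^ 2 + A 1 ^ 2)) - β₂ ^ 2 * A 0 ^ 2 := by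
    refine Continuous.continuousAt (by fun_prop) |>.eventually_const_lt ?_
    simp
    linarith
  filter_upwards [c0, c1] with A h0 h1 hcrit
  have g0 := hcrit 0
  have g1 := hcrit 1
  have g2 := hcrit 2
  rw [amplitudeGradient_zero] at g0
  rw [amplitudeGradient_one] at g1
  rw [amplitudeGradient_two] at g2
  have e1 : A 1 = 0 := by
    refine (mul_eq_zero.1 ?_).resolve_right h1.ne'
    linear_combination (μ₀ + K₀ * A 2 ^ 2 + K₂ * (A 0 ^ 2 + A 1 ^ 2)) * g1 - β₂ * A 0 * g2
  have e2 : A 2 = 0 := by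
    refine (mul_eq_zero.1 ?_).resolve_right h1.ne'
    linear_combination (μ₀ + K₀ * A 1 ^ 2 + K₂ * (A 2 ^ 2 + A 0 ^ 2)) * g2 - β₂ * A 0 * g1
  have e0 : A 0 = ρ := by
    have hA0 : A 0 ≠ 0 := fun h => by simp [h] at h0
    have h3 : (K₀ * (A 0 + ρ)) * (A 0 - ρ) = 0 := by
      refine (mul_eq_zero.1 ?_).resolve_left hA0
      rw [e1, e2] at g0
      linear_combination g0 - A 0 * hρ
    have h4 : A 0 + ρ ≠ 0 := fun h => by
      have : A 0 = -ρ := by linarith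
      rw [this] at h0
      nlinarith
    exact sub_eq_zero.1 ((mul_eq_zero.1 h3).resolve_left (mul_ne_zero hK₀.ne h4))
  ext j
  fin_cases j <;> simp [e0, e1, e2]

end NehariMinimum

/-! ### The threshold `μ₁` and the energy order of rolls and hexagons. -/

section Threshold

variable {θ c₀ μ₀ β₂ K₀ K₂ : ℝ}

theorem exists_downHexagons_eq (hμ : 0 < μ₀) (hK : K₀ + 2 * K₂ < 0) :
    ∃ α > 0, downHexagons μ₀ β₂ K₀ K₂ = (fun _ => -α) ∧
      μ₀ = β₂ * α - (K₀ + 2 * K₂) * α ^ 2 := by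
  have hpos : 0 < -(4 * μ₀ * (K₀ + 2 * K₂)) := by
    have := mul_pos hμ (neg_pos.2 hK)
    linarith
  set s := √(β₂ ^ 2 - 4 * μ₀ * (K₀ + 2 * K₂)) with hs
  have hs2 : s ^ 2 = β₂ ^ 2 - 4 * μ₀ * (K₀ + 2 * K₂) :=
    sq_sqrt (by linarith [sq_nonneg β₂])
  have hβs : β₂ < s := lt_sqrt_of_sq_lt (by linarith)
  refine ⟨(-β₂ + s) / (2 * -(K₀ + 2 * K₂)), div_pos (by linarith) (by linarith), ?_, ?_⟩
  · ext j
    simp only [downHexagons, ← hs]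
    rw [mul_neg, div_neg, neg_neg]
  · have h0 : K₀ + 2 * K₂ ≠ 0 := hK.ne
    field_simp
    linear_combination hs2

/-- The auxiliary root `R = √(2 K₀ (K₀ + K₂))`, in terms of which the threshold is rational. -/
theorem exists_muOne_root (hK : K₀ < K₂) (hK₂ : K₂ < 0) : ∃ R : ℝ, R ^ 2 = 2 * K₀ * (K₀ + K₂) ∧
    -(K₀ + K₂) < R ∧ 2 * R ≤ -(3 * K₀ + K₂) ∧
    muOne β₂ K₀ K₂ = -(β₂ ^ 2 * K₀) / (-(2 * (K₀ + K₂) * R) - 2 * K₀ * (K₀ + 3 * K₂)) := by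
  have hK₀ : K₀ < 0 := hK.trans hK₂
  have h2 : 0 < 2 * K₀ * (K₀ + K₂) := by nlinarith
  refine ⟨√(2 * K₀ * (K₀ + K₂)), sq_sqrt h2.le, lt_sqrt_of_sq_lt (by nlinarith), ?_, ?_⟩
  · have h : √(2 * K₀ * (K₀ + K₂)) ≤ -(3 * K₀ + K₂) / 2 :=
      sqrt_le_iff.2 ⟨by linarith, by nlinarith [sq_nonneg (K₀ - K₂)]⟩
    linarith
  · have h : √2 * √(K₀ * (K₀ + K₂) ^ 3) = -(K₀ + K₂) * √(2 * K₀ * (K₀ + K₂)) := by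
      rw [← sqrt_mul zero_le_two,
        show 2 * (K₀ * (K₀ + K₂) ^ 3) = (-(K₀ + K₂)) ^ 2 * (2 * K₀ * (K₀ + K₂)) by ring,
        sqrt_mul (sq_nonneg _), sqrt_sq (by linarith)]
    unfold muOne
    congr 1
    linear_combination 2 * h

/-- The threshold in terms of the amplitude `α` of the down-hexagons. -/
theorem muOne_spec (hK : K₀ < K₂) (hK₂ : K₂ < 0) :
    ∃ r : ℝ, K₂ - K₀ < r ∧ r * (r - 4 * K₂) = -(2 * (K₀ + 2 * K₂) * (K₂ - K₀)) ∧
      muOne β₂ K₀ K₂ * r ^ 2 = β₂ ^ 2 * (r - (K₀ + 2 * K₂)) ∧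
      -(β₂ ^ 2 * K₀) ≤ muOne β₂ K₀ K₂ * (K₂ - K₀) ^ 2 ∧ 0 ≤ muOne β₂ K₀ K₂ ∧
      (0 < β₂ → 0 < muOne β₂ K₀ K₂) := by
  have hK₀ : K₀ < 0 := hK.trans hK₂
  obtain ⟨R, hR2, hR, hR', hmu⟩ := exists_muOne_root (β₂ := β₂) hK hK₂
  set den := -(2 * (K₀ + K₂) * R) - 2 * K₀ * (K₀ + 3 * K₂) with hden
  have hrpos : 0 < R + 2 * K₂ := by linarith
  -- This factorisation shows the denominator of `μ₁` to be positive and turns `μ₁` into a rational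
  -- function of `R + 2 * K₂`.
  have hden_eq : (R - K₀) * den = -K₀ * (R + 2 * K₂) ^ 2 := by
    rw [hden]
    linear_combination (-(2 * (K₀ + K₂)) + K₀) * hR2
  have hdenpos : 0 < den := by
    have h1 : 0 < (R - K₀) * den := by
      rw [hden_eq]
      exact mul_pos (neg_pos.2 hK₀) (pow_pos hrpos 2)
    exact pos_of_mul_pos_right h1 (by linarith)
  have hdenle : den ≤ (K₂ - K₀) ^ 2 := by
    have := mul_le_mul_of_nonneg_left hR' (by linarith : 0 ≤ -(K₀ + K₂))
    rw [hden]
    linarith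
  have hmd : muOne β₂ K₀ K₂ * den = -(β₂ ^ 2 * K₀) := by
    rw [hmu]
    exact div_mul_cancel₀ _ hdenpos.ne'
  have hnum : 0 ≤ -(β₂ ^ 2 * K₀) := by
    have := mul_nonneg (sq_nonneg β₂) (neg_pos.2 hK₀).le
    linarith
  have hmu0 : 0 ≤ muOne β₂ K₀ K₂ := by
    rw [hmu]
    exact div_nonneg hnum hdenpos.le
  -- This `r` is the root that makes the energy difference in `roll_sub_hexagons_energy` factor; `K₂
  -- - K₀ < r` will give isolation of the hexagons below `μ₁`.
  refine ⟨R + 2 * K₂, by linarith, by linear_combination hR2, ?_, ?_, hmu0, fun hβ => ?_⟩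
  · have h1 : K₀ * (muOne β₂ K₀ K₂ * (R + 2 * K₂) ^ 2) = K₀ * (β₂ ^ 2 * (R - K₀)) := by
      linear_combination muOne β₂ K₀ K₂ * hden_eq - (R - K₀) * hmd
    rw [mul_left_cancel₀ hK₀.ne h1]
    ring
  · rw [← hmd]
    exact mul_le_mul_of_nonneg_left hdenle hmu0
  · rw [hmu]
    exact div_pos (by linarith [mul_pos (pow_pos hβ 2) (neg_pos.2 hK₀)]) hdenpos

/-- Comparison of the energies of roll waves and down-hexagons. -/
theorem roll_sub_hexagons_energy {α r : ℝ} (hα : μ₀ = β₂ * α - (K₀ + 2 * K₂) * α ^ 2)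
    (hr : r * (r - 4 * K₂) = -(2 * (K₀ + 2 * K₂) * (K₂ - K₀))) :
    μ₀ ^ 2 - -K₀ * (4 * amplitudePotential μ₀ β₂ K₀ K₂ (fun _ => -α))
      = α ^ 2 * ((β₂ - r * α) * (β₂ + (r - 4 * K₂) * α)) := by
  rw [amplitudePotential_hexagons hα]
  subst hα
  linear_combination α ^ 4 * hr

/-- `m` is the value of `μ₀` at which the hexagon amplitude is `β₂ / r`, and `μ₀` increases with
that amplitude. -/
theorem mul_amplitude_lt_iff_lt_muOne (hβ₂ : 0 ≤ β₂) (hK : K₀ + 2 * K₂ < 0) {α r m : ℝ}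
    (hα0 : 0 < α) (hα : μ₀ = β₂ * α - (K₀ + 2 * K₂) * α ^ 2) (hr : 0 < r)
    (hm : m * r ^ 2 = β₂ ^ 2 * (r - (K₀ + 2 * K₂))) :
    (μ₀ < m → r * α < β₂) ∧ (m < μ₀ → β₂ < r * α) := by
  have h1 : (μ₀ - m) * r ^ 2 = (r * α - β₂) * (β₂ * r + -(K₀ + 2 * K₂) * (r * α + β₂)) := by
    subst hα
    linear_combination -hm
  have h2 : 0 < β₂ * r + -(K₀ + 2 * K₂) * (r * α + β₂) :=
    add_pos_of_nonneg_of_pos (by positivity) (mul_pos (by linarith) (by positivity))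
  have h3 : 0 < r ^ 2 := by positivity
  constructor <;> intro h
  · by_contra hcon
    have h4 := mul_nonneg (sub_nonneg.2 (not_lt.1 hcon)) h2.le
    have h5 := mul_pos (sub_pos.2 h) h3
    linarith
  · by_contra hcon
    have h4 := mul_nonneg (sub_nonneg.2 (not_lt.1 hcon)) h2.le
    have h5 := mul_pos (sub_pos.2 h) h3
    linarith

theorem exists_heteroclinic_roll (hθ : θ ∈ Ioo 0 (π / 6)) (hc₀ : 0 < c₀) (hβ₂ : 0 ≤ β₂)
    (hK₂ : K₂ < 0) (hK : K₀ < K₂) (hμ : muOne β₂ K₀ K₂ < μ₀) {ρ : ℝ}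
    (hρ : μ₀ + K₀ * ρ ^ 2 = 0) :
    ∃ u, IsHeteroclinicOrbit (reducedField θ c₀ μ₀ β₂ K₀ K₂) (![ρ, 0, 0], 0) (0, 0) u := by
  have hK₀ : K₀ < 0 := hK.trans hK₂
  have hK02 : K₀ + 2 * K₂ < 0 := by linarith
  obtain ⟨r, hr, hr2, hmr, hmD, hm0, -⟩ := muOne_spec (β₂ := β₂) hK hK₂
  have hμ0 : 0 < μ₀ := hm0.trans_lt hμ
  obtain ⟨α, hα0, -, hα⟩ := exists_downHexagons_eq (β₂ := β₂) hμ0 hK02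
  have hrα := (mul_amplitude_lt_iff_lt_muOne hβ₂ hK02 hα0 hα (by linarith) hmr).2 hμ
  have hcmp := roll_sub_hexagons_energy hα hr2
  have hρ0 : ρ ≠ 0 := by
    rintro rfl
    simp at hρ
    linarith
  have hVρ : 4 * amplitudePotential μ₀ β₂ K₀ K₂ ![ρ, 0, 0] = μ₀ * ρ ^ 2 := by
    simp [amplitudePotential]
    linear_combination ρ ^ 2 * hρ
  have hVR : -K₀ * (4 * amplitudePotential μ₀ β₂ K₀ K₂ ![ρ, 0, 0]) = μ₀ ^ 2 := by
    rw [hVρ]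
    linear_combination (-μ₀) * hρ
  have hP0 : ![ρ, 0, 0] ≠ (0 : Fin 3 → ℝ) := fun h => hρ0 (congrFun h 0)
  refine exists_isHeteroclinicOrbit_of_nehari_min hθ hc₀ hμ0 hK₀ hK₂ hP0 (fun j => ?_)
    (fun A hA hN => le_amplitudePotential_of_le_roll_of_le_hexagons hμ0 hβ₂ hK₂ hK hα0 hα hVR.le
      ?_ hA hN) (eventually_eq_roll hK₀ hρ0 hρ ?_)
  · fin_cases j
    · refine amplitudeGradient_zero.trans ?_
      simp
      linear_combination ρ * hρ
    · exact amplitudeGradient_one.trans (by simp)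
    · exact amplitudeGradient_two.trans (by simp)
  · have h1 : 0 ≤ α ^ 2 * ((r * α - β₂) * (β₂ + (r - 4 * K₂) * α)) := by
      have h2 : 0 ≤ (r - 4 * K₂) * α := mul_nonneg (by linarith) hα0.le
      exact mul_nonneg (sq_nonneg α) (mul_nonneg (by linarith) (by linarith))
    have h3 : -K₀ * (4 * amplitudePotential μ₀ β₂ K₀ K₂ ![ρ, 0, 0])
        ≤ -K₀ * (4 * amplitudePotential μ₀ β₂ K₀ K₂ (fun _ => -α)) := by linarith
    have h4 := le_of_mul_le_mul_left h3 (neg_pos.2 hK₀)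
    linarith
  -- Nondegeneracy of the roll amounts to `-K₀ β₂² < μ₀ (K₂ - K₀)²`, which the bound on `muOne` in
  -- `hmD` supplies.
  · have hρ2 : 0 < ρ ^ 2 := by positivity
    have h1 : (μ₀ + K₂ * ρ ^ 2) ^ 2 = (K₂ - K₀) ^ 2 * (ρ ^ 2 * ρ ^ 2) := by
      have h2 : μ₀ + K₂ * ρ ^ 2 = (K₂ - K₀) * ρ ^ 2 := by linear_combination hρ
      rw [h2]
      ring
    rw [h1, ← mul_assoc]
    refine mul_lt_mul_of_pos_right ?_ hρ2
    refine lt_of_mul_lt_mul_left ?_ (neg_pos.2 hK₀).le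
    have h3 : -K₀ * ((K₂ - K₀) ^ 2 * ρ ^ 2) = μ₀ * (K₂ - K₀) ^ 2 := by
      linear_combination (-(K₂ - K₀) ^ 2) * hρ
    rw [h3]
    have h4 : muOne β₂ K₀ K₂ * (K₂ - K₀) ^ 2 < μ₀ * (K₂ - K₀) ^ 2 :=
      mul_lt_mul_of_pos_right hμ (pow_pos (by linarith) 2)
    linarith

theorem exists_heteroclinic_hexagons (hθ : θ ∈ Ioo 0 (π / 6)) (hc₀ : 0 < c₀) (hβ₂ : 0 ≤ β₂)
    (hμ : 0 < μ₀) (hK₀ : K₀ < 0) (hK₂ : K₂ < 0) {α : ℝ} (hα0 : 0 < α)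
    (hα : μ₀ = β₂ * α - (K₀ + 2 * K₂) * α ^ 2) (hαβ : (K₂ - K₀) * α < β₂)
    (hmin : ∀ A, A ≠ 0 → nehari μ₀ β₂ K₀ K₂ A = 0 →
      amplitudePotential μ₀ β₂ K₀ K₂ (fun _ => -α) ≤ amplitudePotential μ₀ β₂ K₀ K₂ A) :
    ∃ u, IsHeteroclinicOrbit (reducedField θ c₀ μ₀ β₂ K₀ K₂) (fun _ => -α, 0) (0, 0) u :=
  exists_isHeteroclinicOrbit_of_nehari_min hθ hc₀ hμ hK₀ hK₂
    (fun h => hα0.ne' (neg_eq_zero.1 (congrFun h 0))) (amplitudeGradient_hexagons hα) hmin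
    (eventually_eq_hexagons hβ₂ (by linarith) hα0 hα hαβ)

end Threshold

theorem mainTheorem3 (θ c₀ β₂ K₀ K₂ : ℝ) (hθ : θ ∈ Ioo 0 (π / 6)) (hc₀ : 0 < c₀)
    (hβ₂ : 0 ≤ β₂) (hK₀ : K₀ < 0) (hK₂ : K₂ < 0) :
    (K₂ < K₀ → ∀ μ₀ : ℝ, 0 < μ₀ →
      ∃ u : ℝ → (Fin 3 → ℝ) × (Fin 3 → ℝ),
        IsHeteroclinicOrbit (reducedField θ c₀ μ₀ β₂ K₀ K₂)
          (downHexagons μ₀ β₂ K₀ K₂, 0) (0, 0) u) ∧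
    (K₀ < K₂ → ∃ μ₁ : ℝ, μ₁ = muOne β₂ K₀ K₂ ∧ 0 ≤ μ₁ ∧ (0 < β₂ → 0 < μ₁) ∧
      (∀ μ₀ : ℝ, 0 < μ₀ → μ₀ < μ₁ →
        ∃ u : ℝ → (Fin 3 → ℝ) × (Fin 3 → ℝ),
          IsHeteroclinicOrbit (reducedField θ c₀ μ₀ β₂ K₀ K₂)
            (downHexagons μ₀ β₂ K₀ K₂, 0) (0, 0) u) ∧
      (∀ μ₀ : ℝ, μ₁ < μ₀ →
        (∃ u : ℝ → (Fin 3 → ℝ) × (Fin 3 → ℝ),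
          IsHeteroclinicOrbit (reducedField θ c₀ μ₀ β₂ K₀ K₂)
            (rollWave μ₀ K₀, 0) (0, 0) u) ∧
        (∃ u : ℝ → (Fin 3 → ℝ) × (Fin 3 → ℝ),
          IsHeteroclinicOrbit (reducedField θ c₀ μ₀ β₂ K₀ K₂)
            (-rollWave μ₀ K₀, 0) (0, 0) u))) := by
  constructor
  · intro hK μ₀ hμ
    have hK02 : K₀ + 2 * K₂ < 0 := by linarith
    obtain ⟨α, hα0, hH, hα⟩ := exists_downHexagons_eq (β₂ := β₂) hμ hK02
    rw [hH]
    refine exists_heteroclinic_hexagons hθ hc₀ hβ₂ hμ hK₀ hK₂ hα0 hα ?_ fun A hA hN =>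
      hexagons_le_amplitudePotential hμ hβ₂ hK₀ hK hα0 hα hA hN
    linarith [mul_neg_of_neg_of_pos (sub_neg.2 hK) hα0]
  · intro hK
    obtain ⟨r, hr, hr2, hmr, -, hm0, hmpos⟩ := muOne_spec (β₂ := β₂) hK hK₂
    have hK02 : K₀ + 2 * K₂ < 0 := by linarith
    refine ⟨_, rfl, hm0, hmpos, fun μ₀ hμ hμ1 => ?_, fun μ₀ hμ1 => ?_⟩
    · obtain ⟨α, hα0, hH, hα⟩ := exists_downHexagons_eq (β₂ := β₂) hμ hK02
      rw [hH]
      have hrα := (mul_amplitude_lt_iff_lt_muOne hβ₂ hK02 hα0 hα (by linarith) hmr).1 hμ1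
      -- Below the threshold, the energy comparison `r α < β₂` also keeps the hexagons clear of the
      -- mixed-mode bifurcation.
      have hαβ : (K₂ - K₀) * α < β₂ := (mul_lt_mul_of_pos_right hr hα0).trans hrα
      refine exists_heteroclinic_hexagons hθ hc₀ hβ₂ hμ hK₀ hK₂ hα0 hα hαβ fun A hA hN =>
        le_amplitudePotential_of_le_roll_of_le_hexagons hμ hβ₂ hK₂ hK hα0 hα ?_ le_rfl hA hN
      have hcmp := roll_sub_hexagons_energy hα hr2
      have h1 : 0 ≤ (r - 4 * K₂) * α := mul_nonneg (by linarith) hα0.le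
      have h2 := mul_nonneg (sq_nonneg α)
        (mul_nonneg (sub_nonneg.2 hrα.le) (add_nonneg hβ₂ h1))
      linarith
    · have hμ : 0 < μ₀ := hm0.trans_lt hμ1
      have hρ : μ₀ + K₀ * √(-μ₀ / K₀) ^ 2 = 0 := by
        rw [sq_sqrt (div_nonneg_of_nonpos (by linarith) hK₀.le)]
        field_simp [hK₀.ne]
        ring
      refine ⟨exists_heteroclinic_roll hθ hc₀ hβ₂ hK₂ hK hμ1 hρ, ?_⟩
      have hneg : -rollWave μ₀ K₀ = ![-√(-μ₀ / K₀), 0, 0] := by simp [rollWave]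
      rw [hneg]
      exact exists_heteroclinic_roll hθ hc₀ hβ₂ hK₂ hK hμ1 (by rw [neg_sq]; exact hρ)
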